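/- **Setting.** Let $\dot A$ be a closed, densely defined, symmetric operator with equal finite deficiency indices in a complex Hilbert space $\mathcal H$. Let $\mathcal H_+\subset\mathcal H\subset\mathcal H_-$ be the associated rigged Hilbert space, where $\mathcal H_+=\operatorname{dom}(\dot A^*)$ carries $(f,g)_+=(f,g)+(\dot A^*f,\dot A^*g)$ and $\mathcal H_-$ is the space of bounded antilinear functionals on $\mathcal H_+$. For a bounded operator $\mathbb A:\mathcal H_+\to\mathcal H_-$ the adjoint $\mathbb A^*:\mathcal H_+\to\mathcal H_-$ is given by $(\mathbb A^*f,g)=(f,\mathbb Ag)$; put $\operatorname{Re}\mathbb A=\frac12(\mathbb A+\mathbb A^*)$ and $\operatorname{Im}\mathbb A=\frac1{2i}(\mathbb A-\mathbb A^*)$. An *L-system* $\Theta$ with input-output space $\mathbb C$ and direction operator $J=1$ consists of such an $\dot A$, together with: - a non-symmetric main operator $T$ with $\dot A\subset T\subset\dot A^*$, $\rho(T)\neq\emptyset$ and $\operatorname{dom}\dot A=\operatorname{dom}T\cap\operatorname{dom}T^*$; - a bounded operator $\mathbb A:\mathcal H_+\to\mathcal H_-$ with $\mathbb A\supset T\supset\dot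 A$ and $\mathbb A^*\supset T^*\supset\dot A$, such that $\operatorname{Re}\mathbb A\supset\dot A$ and the quasi-kernel $\hat A$ of $\operatorname{Re}\mathbb A$ (its restriction to $\{f\in\mathcal H_+:\operatorname{Re}\mathbb A f\in\mathcal H\}$) is self-adjoint in $\mathcal H$; - a bounded operator $K:\mathbb C\to\mathcal H_-$, with adjoint $K^*:\mathcal H_+\to\mathbb C$, such that $\operatorname{Im}\mathbb A=KK^*$ and $\operatorname{ran}K=\operatorname{ran}\operatorname{Im}\mathbb A$. Its transfer function and impedance function are $$W_\Theta(z)=1-2iK^*(\mathbb A-zI)^{-1}K\quad(z\in\rho(T)),\qquad V_\Theta(z)=K^*(\operatorname{Re}\mathbb A-zI)^{-1}K\quad(z\in\rho(\hat A)).$$ For $\alpha\in[0,\pi)$, an L-system $\Theta_\alpha$ with input-output space $\mathbb C$ and $J=1$ (possibly with another state space) is a *unimodular transformation* of $\Theta$ if $W_{\Theta_\alpha}(z)=W_\Theta(z)\cdot(-e^{2i\alpha})$ for all $z$ at which both transfer functions are defined. The *Donoghue class* $\mathfrak M$ consists of all analytic maps $M$ of the open upper half-plane $\mathbb C_+$ into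 itself of the form $$M(z)=\int_{\mathbb R}\Big(\frac1{\lambda-z}-\frac{\lambda}{1+\lambda^2}\Big)\,d\mu(\lambda),\qquad z\in\mathbb C_+,$$ where $\mu$ is an infinite Borel measure on $\mathbb R$ (that is, $\mu(\mathbb R)=\infty$) with $\int_{\mathbb R}\frac{d\mu(\lambda)}{1+\lambda^2}=1$ (equivalently, $M(i)=i$). **Theorem.** Let $\alpha\in[0,\pi)$ and let $\Theta_\alpha$ be a unimodular transformation of an L-system $\Theta$ with input-output space $\mathbb C$ and $J=1$. If the impedance function $V_\Theta$ belongs to $\mathfrak M$, then $V_{\Theta_\alpha}$ belongs to $\mathfrak M$. -/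

import Mathlib

open scoped InnerProductSpace ENNReal

noncomputable section

namespace Rigged

variable {H : Type*} [NormedAddCommGroup H] [InnerProductSpace ℂ H] [CompleteSpace H]

/-! ### Unbounded operators

Mathlib's inner product `⟪x, y⟫_ℂ` is linear in the second variable, so the inner product `(f, g)`
that is linear in the first variable is `⟪g, f⟫_ℂ`. -/

/-- The resolvent set of an operator `T` in `H`: all `z` for which `T - zI` maps `dom T` bijectively
onto `H` with a bounded inverse `R`. -/
def resolventSet (T : H →ₗ.[ℂ] H) : Set ℂ :=
  {z | ∃ R : H →L[ℂ] H,
    (∀ h : H, ∃ x : T.domain, (x : H) = R h ∧ T x - z • (x : H) = h) ∧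
    ∀ x : T.domain, R (T x - z • (x : H)) = x}

/-- The deficiency subspace `ker (A* - zI)`, as a subspace of `dom A*`. -/
def deficiencySubspace (A : H →ₗ.[ℂ] H) (z : ℂ) : Submodule ℂ A.adjoint.domain :=
  LinearMap.ker (A.adjoint.toFun - z • A.adjoint.domain.subtype)

/-- A closed, densely defined, symmetric operator with equal finite deficiency indices. -/
structure IsAdmissible (A : H →ₗ.[ℂ] H) : Prop where
  dense : Dense (A.domain : Set H)
  closed : A.IsClosed
  symmetric : A.IsFormalAdjoint A
  finite_pos : FiniteDimensional ℂ (deficiencySubspace A Complex.I)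
  finite_neg : FiniteDimensional ℂ (deficiencySubspace A (-Complex.I))
  equal_indices : Module.finrank ℂ (deficiencySubspace A Complex.I) =
    Module.finrank ℂ (deficiencySubspace A (-Complex.I))

/-- `T` is a quasi-self-adjoint extension of `A`: a non-symmetric operator with `A ⊂ T ⊂ A*`. -/
structure IsQuasiSelfAdjointExtension (A T : H →ₗ.[ℂ] H) : Prop where
  le : A ≤ T
  le_adjoint : T ≤ A.adjoint
  not_symmetric : ¬ T.IsFormalAdjoint T

/-- The class `Λ(A)`: quasi-self-adjoint extensions `T` of `A` with non-empty resolvent set and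
`dom A = dom T ∩ dom T*`. -/
structure IsClassLambda (A T : H →ₗ.[ℂ] H) : Prop where
  quasi : IsQuasiSelfAdjointExtension A T
  resolvent_nonempty : (resolventSet T).Nonempty
  domain_eq : A.domain = T.domain ⊓ T.adjoint.domain

/-! ### The rigged Hilbert space `H₊ ⊂ H ⊂ H₋` -/

/-- The space `H₊ = dom A*`. -/
def HPlus (A : H →ₗ.[ℂ] H) : Type _ := A.adjoint.domain

instance (A : H →ₗ.[ℂ] H) : AddCommGroup (HPlus A) :=
  inferInstanceAs (AddCommGroup A.adjoint.domain)

instance (A : H →ₗ.[ℂ] H) : Module ℂ (HPlus A) :=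
  inferInstanceAs (Module ℂ A.adjoint.domain)

/-- The inclusion `H₊ ⊂ H` as a linear map. -/
def HPlus.val (A : H →ₗ.[ℂ] H) : HPlus A →ₗ[ℂ] H := A.adjoint.domain.subtype

/-- The action of `A*` on `H₊ = dom A*`. -/
def HPlus.star (A : H →ₗ.[ℂ] H) : HPlus A →ₗ[ℂ] H := A.adjoint.toFun

/-- The inner product of `H₊`: `(f, g)₊ = (f, g) + (A* f, A* g)`. -/
@[reducible] def HPlus.core (A : H →ₗ.[ℂ] H) : InnerProductSpace.Core ℂ (HPlus A) where
  inner f g := ⟪HPlus.val A f, HPlus.val A g⟫_ℂ + ⟪HPlus.star A f, HPlus.star A g⟫_ℂ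
  conj_inner_symm f g := by simp
  re_inner_nonneg f := by
    have h1 := inner_self_nonneg (𝕜 := ℂ) (x := HPlus.val A f)
    have h2 := inner_self_nonneg (𝕜 := ℂ) (x := HPlus.star A f)
    simpa using add_nonneg h1 h2
  add_left f g h := by simp only [map_add, inner_add_left]; ring
  smul_left f g c := by simp only [map_smul, inner_smul_left]; ring
  definite f hf := by
    have h1 := inner_self_nonneg (𝕜 := ℂ) (x := HPlus.val A f)
    have h2 := inner_self_nonneg (𝕜 := ℂ) (x := HPlus.star A f)
    have h3 := congrArg RCLike.re hf
    simp only [map_add, map_zero] at h3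
    have h4 : RCLike.re ⟪HPlus.val A f, HPlus.val A f⟫_ℂ = 0 := by linarith
    have h5 : HPlus.val A f = 0 := by
      rw [inner_self_eq_norm_sq] at h4
      simpa using h4
    exact Subtype.ext h5

instance (A : H →ₗ.[ℂ] H) : NormedAddCommGroup (HPlus A) := (HPlus.core A).toNormedAddCommGroup

instance (A : H →ₗ.[ℂ] H) : InnerProductSpace ℂ (HPlus A) :=
  InnerProductSpace.ofCore (HPlus.core A).toCore

/-- The space `H₋`: the antilinear dual of `H₊`, that is, the bounded antilinear functionals
`g ↦ (φ, g)` on `H₊`, with the dual norm. -/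
abbrev HMinus (A : H →ₗ.[ℂ] H) : Type _ := HPlus A →L⋆[ℂ] ℂ

/-- The inclusion `H₊ ⊂ H`; it is a contraction. -/
def inclPlus (A : H →ₗ.[ℂ] H) : HPlus A →L[ℂ] H :=
  (HPlus.val A).mkContinuous 1 fun f => by
    have h1 : ‖f‖ ^ 2 = ‖HPlus.val A f‖ ^ 2 + ‖HPlus.star A f‖ ^ 2 := by
      rw [← inner_self_eq_norm_sq (𝕜 := ℂ) f, ← inner_self_eq_norm_sq (𝕜 := ℂ) (HPlus.val A f),
        ← inner_self_eq_norm_sq (𝕜 := ℂ) (HPlus.star A f), ← map_add]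
      rfl
    rw [one_mul]
    exact le_of_sq_le_sq (by nlinarith [sq_nonneg ‖HPlus.star A f‖]) (norm_nonneg f)

/-- The inclusion `H ⊂ H₋`: the vector `h` is the functional `g ↦ (h, g)`. -/
def inclMinus (A : H →ₗ.[ℂ] H) : H →L[ℂ] HMinus A :=
  ((innerSL ℂ).comp (inclPlus A)).flip

theorem inclMinus_apply (A : H →ₗ.[ℂ] H) (h : H) (g : HPlus A) :
    inclMinus A h g = ⟪inclPlus A g, h⟫_ℂ := rfl

/-! ### Bi-extensions: operators from `H₊` to `H₋` -/

/-- The adjoint of `B ∈ [H₊, H₋]`, again in `[H₊, H₋]`: `(B* f, g) = (f, B g)`, that is, the complex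
conjugate of `(B g, f)`. -/
def adj {A : H →ₗ.[ℂ] H} (B : HPlus A →L[ℂ] HMinus A) : HPlus A →L[ℂ] HMinus A :=
  (ContinuousLinearMap.compSL (HPlus A) ℂ ℂ (RingHom.id ℂ) (starRingEnd ℂ)
    (starL ℂ : ℂ ≃L⋆[ℂ] ℂ).toContinuousLinearMap).comp B.flip

theorem adj_apply {A : H →ₗ.[ℂ] H} (B : HPlus A →L[ℂ] HMinus A) (f g : HPlus A) :
    adj B f g = (starRingEnd ℂ) (B g f) := rfl

/-- `Re B = (B + B*) / 2`. -/
def rePart {A : H →ₗ.[ℂ] H} (B : HPlus A →L[ℂ] HMinus A) : HPlus A →L[ℂ] HMinus A :=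
  (1 / 2 : ℂ) • (B + adj B)

/-- `Im B = (B - B*) / (2i)`. -/
def imPart {A : H →ₗ.[ℂ] H} (B : HPlus A →L[ℂ] HMinus A) : HPlus A →L[ℂ] HMinus A :=
  (1 / (2 * Complex.I)) • (B - adj B)

/-- `B ⊃ S`, for `B ∈ [H₊, H₋]` and an operator `S` in `H`: every `x ∈ dom S` lies in `H₊` and
`B x = S x ∈ H ⊂ H₋`. -/
def Contains {A : H →ₗ.[ℂ] H} (B : HPlus A →L[ℂ] HMinus A) (S : H →ₗ.[ℂ] H) : Prop :=
  ∀ x : S.domain, ∃ f : HPlus A, inclPlus A f = x ∧ B f = inclMinus A (S x)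

/-- The graph `{(f, h) | f ∈ H₊, h ∈ H, B f = h}` of the quasi-kernel of `B`. -/
def quasiKernelGraph {A : H →ₗ.[ℂ] H} (B : HPlus A →L[ℂ] HMinus A) : Submodule ℂ (H × H) where
  carrier := {p | ∃ f : HPlus A, inclPlus A f = p.1 ∧ B f = inclMinus A p.2}
  add_mem' := by
    rintro p q ⟨f, hf, hf'⟩ ⟨g, hg, hg'⟩
    exact ⟨f + g, by simp [hf, hg], by simp [hf', hg']⟩
  zero_mem' := ⟨0, by simp, by simp⟩
  smul_mem' := by
    rintro c p ⟨f, hf, hf'⟩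
    exact ⟨c • f, by simp [hf], by simp [hf']⟩

/-- The quasi-kernel of `B`: the restriction of `B` to `{f ∈ H₊ | B f ∈ H}`, as an operator in `H`.
(The graph is single-valued whenever `H₊` is dense in `H`.) -/
def quasiKernel {A : H →ₗ.[ℂ] H} (B : HPlus A →L[ℂ] HMinus A) : H →ₗ.[ℂ] H :=
  (quasiKernelGraph B).toLinearPMap

/-- `B` is a self-adjoint bi-extension of `A`. -/
structure IsSelfAdjointBiExtension {A : H →ₗ.[ℂ] H} (B : HPlus A →L[ℂ] HMinus A) : Prop where
  adj_eq : adj B = B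
  contains : Contains B A

/-- `B` is a t-self-adjoint bi-extension of `A`: its quasi-kernel is self-adjoint in `H`. -/
structure IsTSelfAdjointBiExtension {A : H →ₗ.[ℂ] H} (B : HPlus A →L[ℂ] HMinus A) : Prop where
  biExtension : IsSelfAdjointBiExtension B
  quasiKernel_selfAdjoint : IsSelfAdjoint (quasiKernel B)

/-- `B` is a (∗)-extension of `T`: `B ⊃ T ⊃ A`, `B* ⊃ T* ⊃ A`, and `Re B` is a t-self-adjoint
bi-extension of `A`. -/
structure IsStarExtension {A : H →ₗ.[ℂ] H} (T : H →ₗ.[ℂ] H) (B : HPlus A →L[ℂ] HMinus A) :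
    Prop where
  contains : Contains B T
  le : A ≤ T
  adj_contains : Contains (adj B) T.adjoint
  le_adjoint : A ≤ T.adjoint
  re_tSelfAdjoint : IsTSelfAdjointBiExtension (rePart B)

/-- `(B - zI)⁻¹ : H₋ → H₊`, giving a solution `x` of `(B - zI) x = φ` whenever there is one.
For the state-space operator `B` of an L-system with main operator `T`, the solution exists and is
unique for `z ∈ ρ(T)` and `φ ∈ H + ran K`; the same holds for `Re B` and `z` in the resolvent
set of its quasi-kernel. -/
def resolvent {A : H →ₗ.[ℂ] H} (B : HPlus A →L[ℂ] HMinus A) (z : ℂ) : HMinus A → HPlus A :=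
  Function.invFun fun x => B x - z • inclMinus A (inclPlus A x)

/-- The adjoint `K* ∈ [H₊, E]` of `K ∈ [E, H₋]`: `(K* f, e)_E = (f, K e)`. -/
def channelAdjoint {E : Type*} [NormedAddCommGroup E] [InnerProductSpace ℂ E] [CompleteSpace E]
    {A : H →ₗ.[ℂ] H} (K : E →L[ℂ] HMinus A) : HPlus A →L[ℂ] E :=
  ((InnerProductSpace.toDual ℂ E).symm.toContinuousLinearEquiv.toContinuousLinearMap).comp K.flip

theorem inner_channelAdjoint {E : Type*} [NormedAddCommGroup E] [InnerProductSpace ℂ E]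
    [CompleteSpace E] {A : H →ₗ.[ℂ] H} (K : E →L[ℂ] HMinus A) (f : HPlus A) (e : E) :
    ⟪channelAdjoint K f, e⟫_ℂ = K e f := by
  simp [channelAdjoint]

end Rigged

open Rigged in
/-- An L-system with state space `H₊ ⊂ H ⊂ H₋` and finite-dimensional input-output space `E`. -/
structure LSystem (H E : Type*) [NormedAddCommGroup H] [InnerProductSpace ℂ H] [CompleteSpace H]
    [NormedAddCommGroup E] [InnerProductSpace ℂ E] [CompleteSpace E] [FiniteDimensional ℂ E] where
  /-- the underlying symmetric operator `Ȧ`, with `H₊ = dom Ȧ*` -/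
  symmOp : H →ₗ.[ℂ] H
  symmOp_admissible : IsAdmissible symmOp
  /-- the main operator `T` -/
  mainOp : H →ₗ.[ℂ] H
  mainOp_mem : IsClassLambda symmOp mainOp
  /-- the state-space operator `𝔸 ∈ [H₊, H₋]` -/
  stateOp : HPlus symmOp →L[ℂ] HMinus symmOp
  stateOp_starExtension : IsStarExtension mainOp stateOp
  /-- the direction operator `J = J* = J⁻¹` -/
  J : E →L[ℂ] E
  J_selfAdjoint : IsSelfAdjoint J
  J_involutive : J * J = 1
  /-- the channel operator `K` -/
  K : E →L[ℂ] HMinus symmOp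
  im_stateOp : imPart stateOp = K.comp (J.comp (channelAdjoint K))
  range_K : Set.range K = Set.range (imPart stateOp)

namespace LSystem

open Rigged

variable {H E : Type*} [NormedAddCommGroup H] [InnerProductSpace ℂ H] [CompleteSpace H]
  [NormedAddCommGroup E] [InnerProductSpace ℂ E] [CompleteSpace E] [FiniteDimensional ℂ E]

/-- The transfer function `W(z) = I - 2i K* (𝔸 - zI)⁻¹ K J`, for `z ∈ ρ(T)`. -/
def transfer (Θ : LSystem H E) (z : ℂ) (e : E) : E :=
  e - (2 * Complex.I) • channelAdjoint Θ.K (resolvent Θ.stateOp z (Θ.K (Θ.J e)))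

/-- The impedance function `V(z) = K* (Re 𝔸 - zI)⁻¹ K`, for `z` in the resolvent set of the
quasi-kernel of `Re 𝔸`, in particular for all non-real `z`. -/
def impedance (Θ : LSystem H E) (z : ℂ) (e : E) : E :=
  channelAdjoint Θ.K (resolvent (rePart Θ.stateOp) z (Θ.K e))

/-- The scalar impedance function of an L-system with input-output space `ℂ`: the operator `V(z)`
on `ℂ` is multiplication by the number `V(z) 1`. -/
def scalarImpedance (Θ : LSystem H ℂ) (z : ℂ) : ℂ := Θ.impedance z 1

/-- `Θ'` is a unimodular transformation of `Θ` with parameter `α ∈ [0, π)`: both systems have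
`E = ℂ` and `J = 1`, and `W'(z) = W(z) · (-e^{2iα})` wherever both transfer functions are defined.
The two systems may act in different state spaces. -/
structure IsUnimodularTransformation {H' : Type*} [NormedAddCommGroup H'] [InnerProductSpace ℂ H']
    [CompleteSpace H'] (Θ' : LSystem H' ℂ) (Θ : LSystem H ℂ) (α : ℝ) : Prop where
  J_eq : Θ.J = 1
  J_eq' : Θ'.J = 1
  nonneg : 0 ≤ α
  lt_pi : α < Real.pi
  transfer_eq : ∀ z ∈ resolventSet Θ.mainOp ∩ resolventSet Θ'.mainOp, ∀ e : ℂ,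
    Θ'.transfer z e = Θ.transfer z (-Complex.exp (2 * Complex.I * (α : ℂ)) * e)

end LSystem

/-- The Donoghue class: analytic maps `M` of the open upper half-plane into itself of the form
`M(z) = ∫ (1/(λ - z) - λ/(1 + λ²)) dμ(λ)`, with an infinite Borel measure `μ` on `ℝ` such that
`∫ dμ(λ)/(1 + λ²) = 1`. -/
structure IsDonoghue (M : ℂ → ℂ) : Prop where
  analytic : DifferentiableOn ℂ M {z | 0 < z.im}
  mapsTo : Set.MapsTo M {z | 0 < z.im} {z | 0 < z.im}
  representation : ∃ μ : MeasureTheory.Measure ℝ, μ Set.univ = ∞ ∧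
    ∫⁻ t : ℝ, ENNReal.ofReal (1 / (1 + t ^ 2)) ∂μ = 1 ∧
    ∀ z : ℂ, 0 < z.im →
      M z = ∫ t : ℝ, (1 / ((t : ℂ) - z) - (t : ℂ) / (1 + (t : ℂ) ^ 2)) ∂μ

end

/-! In the lower half-plane the transfer and impedance functions satisfy `W = (1 - iV)/(1 + iV)`.
Multiplying `W` by `-e^{2iα}` therefore turns `V` into `V' = (cos α + sin α V)/(sin α - cos α V)`, a
rotation of the half-plane about `i` (`scalarImpedance_rotation`). Since `V(z̄)` is the conjugate of
`V(z)`, the relation passes to the upper half-plane. It remains to see that such rotations preserve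
the Donoghue class (`isDonoghue_of_rotation`).

Operator side. `T` is not symmetric, so `K 1` is a value of `Re 𝔸` modulo `H`, and self-adjointness
of the quasi-kernel makes `(Re 𝔸 - z)x = K 1` solvable for non-real `z`. As `𝔸 = Re 𝔸 + iKK*` is a
rank-one dissipative perturbation, the lower half-plane lies in `ρ(T)` and the relation between `W`
and `V` follows from that one vector `x`.

Analytic side. A rotation keeps analyticity, the half-plane and the fixed point `i`, so the rotated
function `N` has a Herglotz representation `bz + ∫ (1 + tz)/(t - z) dρ`. With `dρ = dμ/(1 + t²)`,
membership in the class means `b = 0` and `∫ (1 + t²) dρ = ∞`. Both are read off at `z = iy`, `y →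
∞`: the original `M` satisfies `Im M(iy)/y → 0` and `y Im M(iy) → ∞`, while `Im N · |s - cM|² = Im
M` and its inverse form exclude `b > 0` and finite mass. -/

namespace Herglotz
open MeasureTheory Filter Topology Complex Metric Set

/-! ### Herglotz representation on the disc -/

/-- **Schwarz integral formula** on the unit disc. -/
theorem circleAverage_kernel_mul_re {G : ℂ → ℂ} (hG : DiffContOnCl ℂ G (ball 0 1)) {w : ℂ}
    (hw : w ∈ ball (0 : ℂ) 1) :
    Real.circleAverage (fun ζ => (ζ + w) / (ζ - w) * ((G ζ).re : ℂ)) 0 1 =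
      G w - (G 0).im * I := by
  have hG' : DiffContOnCl ℂ G (ball 0 |(1 : ℝ)|) := by simpa using hG
  have hw' : ‖w‖ < 1 := by simpa using hw
  have hcont : ContinuousOn G (sphere 0 |(1 : ℝ)|) :=
    hG.continuousOn_ball.mono (by simpa using sphere_subset_closedBall)
  have hne : ∀ ζ ∈ sphere (0 : ℂ) |(1 : ℝ)|, ζ - w ≠ 0 := by
    intro ζ hζ h
    rw [sub_eq_zero] at h
    simp [h] at hζ
    linarith
  have hne' : ∀ ζ ∈ closedBall (0 : ℂ) 1, 1 - (starRingEnd ℂ) w * ζ ≠ 0 := by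
    intro ζ hζ h
    have h1 : ‖(starRingEnd ℂ) w * ζ‖ = 1 := by
      rw [← sub_eq_zero.1 h]; simp
    rw [norm_mul, Complex.norm_conj] at h1
    have h2 : ‖ζ‖ ≤ 1 := by simpa using hζ
    nlinarith [norm_nonneg w, norm_nonneg ζ]
  have c1 : Real.circleAverage (fun ζ => (ζ / (ζ - w)) • G ζ) 0 1 = G w := by
    simpa using hG'.circleAverage_smul_div (by simpa using hw)
  have c2 : Real.circleAverage G 0 1 = G 0 := hG'.circleAverage
  have hH : DiffContOnCl ℂ
      (fun ζ => ((1 + (starRingEnd ℂ) w * ζ) / (1 - (starRingEnd ℂ) w * ζ)) * G ζ)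
      (ball 0 |(1 : ℝ)|) := by
    rw [abs_one]
    have : DiffContOnCl ℂ (fun ζ => (1 + (starRingEnd ℂ) w * ζ) / (1 - (starRingEnd ℂ) w * ζ))
        (ball 0 1) := by
      constructor
      · intro ζ hζ
        have := hne' ζ (ball_subset_closedBall hζ)
        exact DifferentiableAt.differentiableWithinAt (by fun_prop (disch := assumption))
      · rw [closure_ball _ one_ne_zero]
        intro ζ hζ
        have := hne' ζ hζ
        exact ContinuousAt.continuousWithinAt (by fun_prop (disch := assumption))
    exact this.smul hG
  have c3 := hH.circleAverage
  have hHc : ContinuousOn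
      (fun ζ => ((1 + (starRingEnd ℂ) w * ζ) / (1 - (starRingEnd ℂ) w * ζ)) * G ζ)
      (sphere 0 1) := by
    intro ζ hζ
    have h1 := hne' ζ (sphere_subset_closedBall hζ)
    exact ContinuousWithinAt.mul
      (ContinuousAt.continuousWithinAt (by fun_prop (disch := assumption)))
      (hcont.mono (by simp) ζ hζ)
  have c4 : Real.circleAverage (fun ζ => (starRingEnd ℂ)
      (((1 + (starRingEnd ℂ) w * ζ) / (1 - (starRingEnd ℂ) w * ζ)) * G ζ)) 0 1 =
      (starRingEnd ℂ) (G 0) := by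
    have := Complex.conjCLE.toContinuousLinearMap.circleAverage_comp_comm
      (f := fun ζ => ((1 + (starRingEnd ℂ) w * ζ) / (1 - (starRingEnd ℂ) w * ζ)) * G ζ)
      (c := 0) (R := 1) ?_
    · rw [c3] at this
      simpa [Function.comp_def] using this
    · exact ContinuousOn.circleIntegrable (by norm_num) hHc
  -- Write `Re G = (G + conj G)/2`. The `G` part splits by `(ζ + w)/(ζ - w) = 2ζ/(ζ - w) - 1` into a
  -- Cauchy kernel and a mean value. On the circle `conj ζ = 1/ζ`, so the `conj G` part is the
  -- conjugate of a holomorphic function, again averaged by the mean value property.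
  have e : EqOn (fun ζ => (ζ + w) / (ζ - w) * ((G ζ).re : ℂ))
      (fun ζ => ((ζ / (ζ - w)) • G ζ + (-(1 / 2) : ℂ) • G ζ) +
        (1 / 2 : ℂ) • (starRingEnd ℂ)
          (((1 + (starRingEnd ℂ) w * ζ) / (1 - (starRingEnd ℂ) w * ζ)) * G ζ))
      (sphere 0 |(1 : ℝ)|) := by
    intro ζ hζ
    have h1 := hne ζ hζ
    have hζ1 : ‖ζ‖ = 1 := by simpa using hζ
    have h2 : ζ * (starRingEnd ℂ) ζ = 1 := by
      rw [Complex.mul_conj, Complex.normSq_eq_norm_sq, hζ1]; simp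
    have h0 : ζ ≠ 0 := by
      intro h; simp [h] at hζ1
    have h3 : (starRingEnd ℂ) ζ = 1 / ζ := by
      field_simp; rw [mul_comm]; exact h2
    have h4 : ((G ζ).re : ℂ) = (G ζ + (starRingEnd ℂ) (G ζ)) / 2 := Complex.re_eq_add_conj _
    simp only [map_mul, map_div₀, map_add, map_sub, map_one, Complex.conj_conj, h3, smul_eq_mul, h4]
    have h5 : 1 - w * (1 / ζ) ≠ 0 := by
      rw [mul_one_div, one_sub_div h0]; exact div_ne_zero h1 h0
    have h6 : (1 + w * (1 / ζ)) / (1 - w * (1 / ζ)) = (ζ + w) / (ζ - w) := by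
      rw [div_eq_div_iff h5 h1]; field_simp
    rw [h6]
    field_simp
    ring
  have ci1 : CircleIntegrable (fun ζ => (ζ / (ζ - w)) • G ζ) 0 1 := by
    apply ContinuousOn.circleIntegrable (by norm_num)
    intro ζ hζ
    have h1 := hne ζ (by simpa using hζ)
    exact ContinuousWithinAt.smul (f := fun ζ => ζ / (ζ - w))
        (ContinuousAt.continuousWithinAt (by fun_prop (disch := assumption)))
        (hcont.mono (by simp) ζ hζ)
  have ci2 : CircleIntegrable (fun ζ => (-(1 / 2) : ℂ) • G ζ) 0 1 := by
    apply ContinuousOn.circleIntegrable (by norm_num)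
    exact ContinuousOn.const_smul (hcont.mono (by simp)) (-(1 / 2) : ℂ)
  have ci3 : CircleIntegrable (fun ζ => (1 / 2 : ℂ) • (starRingEnd ℂ)
          (((1 + (starRingEnd ℂ) w * ζ) / (1 - (starRingEnd ℂ) w * ζ)) * G ζ)) 0 1 := by
    apply ContinuousOn.circleIntegrable (by norm_num)
    exact ContinuousOn.const_smul (Complex.continuous_conj.comp_continuousOn hHc) (1 / 2 : ℂ)
  rw [Real.circleAverage_congr_sphere e]
  refine (Real.circleAverage_fun_add (ci1.add ci2) ci3).trans ?_
  rw [Real.circleAverage_add ci1 ci2,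
    Real.circleAverage_fun_smul, Real.circleAverage_fun_smul, c1, c2, c4]
  have : (starRingEnd ℂ) (G 0) = G 0 - 2 * (G 0).im * I := by
    apply Complex.ext <;> simp; ring
  rw [this, smul_eq_mul, smul_eq_mul]
  ring

/-- A holomorphic function on the unit disc, continuous up to the boundary, with nonnegative real
part and value `1` at the origin, is the Herglotz integral of a probability measure on the circle. -/
theorem exists_probabilityMeasure_of_diffContOnCl {G : ℂ → ℂ}
    (hG : DiffContOnCl ℂ G (ball 0 1)) (hpos : ∀ ζ ∈ sphere (0 : ℂ) 1, 0 ≤ (G ζ).re)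
    (h0 : G 0 = 1) :
    ∃ ν : ProbabilityMeasure (sphere (0 : ℂ) 1), ∀ w ∈ ball (0 : ℂ) 1,
      ∫ ζ : sphere (0 : ℂ) 1, ((ζ : ℂ) + w) / ((ζ : ℂ) - w) ∂(ν : Measure (sphere (0 : ℂ) 1)) =
        G w := by
  have hcont : Continuous fun θ : ℝ => G (circleMap 0 1 θ) :=
    hG.continuousOn_ball.comp_continuous (continuous_circleMap 0 1)
      fun θ => by simp
  -- The representing measure is `Re G dθ/2π` on the circle; the Schwarz formula at `w = 0` gives it
  -- mass `Re G(0) = 1`.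
  set D : ℝ → ℝ := fun θ => (2 * Real.pi)⁻¹ * (G (circleMap 0 1 θ)).re with hD
  have hDc : Continuous D := continuous_const.mul (Complex.continuous_re.comp hcont)
  have hD0 : ∀ θ, 0 ≤ D θ := fun θ =>
    mul_nonneg (by positivity) (hpos _ (by simp))
  set κ : Measure ℝ := (volume.restrict (Ioc 0 (2 * Real.pi))).withDensity
    fun θ => ENNReal.ofReal (D θ) with hκ
  set e : ℝ → sphere (0 : ℂ) 1 := fun θ => ⟨circleMap 0 1 θ, by simp⟩ with he
  have hec : Continuous e := (continuous_circleMap 0 1).subtype_mk _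
  have hint : ∀ f : ℂ → ℂ, ContinuousOn f (sphere 0 1) →
      ∫ ζ : sphere (0 : ℂ) 1, f ζ ∂(κ.map e) =
        Real.circleAverage (fun ζ => f ζ * ((G ζ).re : ℂ)) 0 1 := by
    intro f hf
    have hf' : Continuous fun ζ : sphere (0 : ℂ) 1 => f ζ := hf.domRestrict
    rw [integral_map hec.measurable.aemeasurable hf'.aestronglyMeasurable, hκ,
      integral_withDensity_eq_integral_toReal_smul (by fun_prop) (by simp),
      Real.circleAverage_def, intervalIntegral.integral_of_le (by positivity),
      ← integral_smul]
    congr 1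
    ext θ
    rw [ENNReal.toReal_ofReal (hD0 θ), hD]
    simp only [Complex.real_smul, Complex.ofReal_mul, he]
    ring
  have havg : Real.circleAverage (fun ζ => ((G ζ).re : ℂ)) 0 1 = 1 := by
    have := circleAverage_kernel_mul_re hG (w := 0) (by simp)
    rw [h0] at this
    rw [← sub_zero (1 : ℂ)]
    convert this using 1
    · apply Real.circleAverage_congr_sphere
      intro ζ hζ
      have : ζ ≠ 0 := by rintro rfl; simp at hζ
      simp [this]
    · simp
  have hfin : IsFiniteMeasure κ := by
    apply isFiniteMeasure_withDensity_ofReal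
    exact (hDc.integrableOn_Ioc).hasFiniteIntegral
  have hone : κ univ = 1 := by
    have h1 := hint (fun _ => 1) continuousOn_const
    simp only [one_mul, havg] at h1
    rw [integral_const, measureReal_def, Measure.map_apply hec.measurable .univ,
      preimage_univ] at h1
    have h2 : (κ univ).toReal = 1 := by
      have := congrArg Complex.re h1
      simpa using this
    rw [← ENNReal.ofReal_toReal (measure_ne_top κ univ), h2, ENNReal.ofReal_one]
  have hprob : IsProbabilityMeasure (κ.map e) :=
    have : IsProbabilityMeasure κ := ⟨hone⟩
    Measure.isProbabilityMeasure_map hec.measurable.aemeasurable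
  refine ⟨⟨κ.map e, hprob⟩, fun w hw => ?_⟩
  have hk : ContinuousOn (fun ζ => (ζ + w) / (ζ - w)) (sphere 0 1) := by
    intro ζ hζ
    have : ζ - w ≠ 0 := by
      intro h
      rw [sub_eq_zero] at h
      simp [h] at hζ hw
      linarith
    exact ContinuousAt.continuousWithinAt (by fun_prop (disch := assumption))
  have h1 := hint _ hk
  rw [circleAverage_kernel_mul_re hG hw, h0] at h1
  simpa using h1

/-- **Herglotz representation theorem** on the unit disc. -/
theorem exists_probabilityMeasure_disc {G : ℂ → ℂ} (hG : DifferentiableOn ℂ G (ball 0 1))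
    (hpos : ∀ ζ ∈ ball (0 : ℂ) 1, 0 ≤ (G ζ).re) (h0 : G 0 = 1) :
    ∃ ν : ProbabilityMeasure (sphere (0 : ℂ) 1), ∀ w ∈ ball (0 : ℂ) 1,
      ∫ ζ : sphere (0 : ℂ) 1, ((ζ : ℂ) + w) / ((ζ : ℂ) - w) ∂(ν : Measure (sphere (0 : ℂ) 1)) =
        G w := by
  have key : ∀ r : ℝ, ∃ ν : ProbabilityMeasure (sphere (0 : ℂ) 1), r ∈ Ioo (0 : ℝ) 1 →
      ∀ w ∈ ball (0 : ℂ) 1,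
      ∫ ζ : sphere (0 : ℂ) 1, ((ζ : ℂ) + w) / ((ζ : ℂ) - w) ∂(ν : Measure (sphere (0 : ℂ) 1)) =
        G (r * w) := by
    intro r
    by_cases hr : r ∈ Ioo (0 : ℝ) 1
    · have hmaps : ∀ w ∈ closedBall (0 : ℂ) 1, (r : ℂ) * w ∈ ball (0 : ℂ) 1 := by
        intro w hw
        have : ‖w‖ ≤ 1 := by simpa using hw
        have hr' : |r| = r := abs_of_pos hr.1
        simp only [mem_ball, dist_zero_right, norm_mul, Complex.norm_real, Real.norm_eq_abs, hr']
        nlinarith [hr.1, hr.2, norm_nonneg w]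
      have hdiff : DifferentiableOn ℂ (fun w => G (r * w)) (closedBall 0 1) :=
        hG.comp (by fun_prop) hmaps
      obtain ⟨ν, hν⟩ := exists_probabilityMeasure_of_diffContOnCl (G := fun w => G (r * w))
        ((hdiff.mono closure_ball_subset_closedBall).diffContOnCl)
        (fun ζ hζ => hpos _ (hmaps ζ (sphere_subset_closedBall hζ))) (by simpa using h0)
      exact ⟨ν, fun _ => hν⟩
    -- Arbitrary value: only radii in `(0, 1)` matter.
    · exact ⟨⟨Measure.dirac ⟨1, by simp⟩, inferInstance⟩, fun h => absurd h hr⟩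
  choose ν hν using key
  -- Probability measures on the compact circle form a compact space, so the measures of the
  -- dilations `G(r ·)` converge weakly along an ultrafilter `r → 1⁻`.
  let U : Ultrafilter ℝ := Ultrafilter.of (𝓝[<] (1 : ℝ))
  have hU : (U : Filter ℝ) ≤ 𝓝[<] (1 : ℝ) := Ultrafilter.of_le _
  obtain ⟨ν₀, hν₀⟩ : ∃ ν₀, Tendsto ν U (𝓝 ν₀) :=
    ⟨_, (U.map ν).le_nhds_lim⟩
  refine ⟨ν₀, fun w hw => ?_⟩
  have hk : Continuous fun ζ : sphere (0 : ℂ) 1 => ((ζ : ℂ) + w) / ((ζ : ℂ) - w) := by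
    refine Continuous.div (by fun_prop) (by fun_prop) fun ζ h => ?_
    have hζ := ζ.2
    rw [sub_eq_zero] at h
    simp [h] at hζ hw
    linarith
  have t1 := (ProbabilityMeasure.tendsto_iff_forall_integral_rclike_tendsto ℂ).1 hν₀
    (BoundedContinuousFunction.mkOfCompact ⟨_, hk⟩)
  have t2 : Tendsto (fun r : ℝ => G (r * w)) U (𝓝 (G w)) := by
    have hc : ContinuousAt G (((1 : ℝ) : ℂ) * w) := by
      rw [Complex.ofReal_one, one_mul]
      exact (hG.differentiableAt (isOpen_ball.mem_nhds hw)).continuousAt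
    have : Tendsto (fun r : ℝ => G (r * w)) (𝓝 1) (𝓝 (G w)) := by
      have h2 : ContinuousAt (fun r : ℝ => (r : ℂ) * w) 1 := by fun_prop
      have := ContinuousAt.comp (f := fun r : ℝ => (r : ℂ) * w) hc h2
      simpa [ContinuousAt, Function.comp_def] using this
    exact this.mono_left (hU.trans nhdsWithin_le_nhds)
  refine tendsto_nhds_unique t1 (t2.congr' ?_)
  have : ∀ᶠ r in 𝓝[<] (1 : ℝ), r ∈ Ioo (0 : ℝ) 1 := Ioo_mem_nhdsLT one_pos
  filter_upwards [hU this] with r hr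
  exact (hν r hr w hw).symm

/-! ### Herglotz–Nevanlinna representation on the half-plane -/

/-- **Herglotz–Nevanlinna representation** of a holomorphic self-map of the upper half-plane that
fixes `I`. -/
theorem exists_measure_upperHalfPlane {N : ℂ → ℂ} (hN : DifferentiableOn ℂ N {z | 0 < z.im})
    (hmaps : MapsTo N {z | 0 < z.im} {z | 0 < z.im}) (hI : N I = I) :
    ∃ (b : ℝ) (ρ : Measure ℝ), 0 ≤ b ∧ IsFiniteMeasure ρ ∧ b + ρ.real univ = 1 ∧
      ∀ z : ℂ, 0 < z.im → N z = b * z + ∫ t : ℝ, (1 + t * z) / (t - z) ∂ρ := by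
  have hne1 : ∀ w ∈ ball (0 : ℂ) 1, 1 - w ≠ 0 := by
    intro w hw h
    rw [sub_eq_zero] at h
    simp [← h] at hw
  have him : ∀ w ∈ ball (0 : ℂ) 1, 0 < (I * (1 + w) / (1 - w)).im := by
    intro w hw
    have h1 : Complex.normSq w < 1 := by
      have : ‖w‖ < 1 := by simpa using hw
      rw [Complex.normSq_eq_norm_sq]; nlinarith [norm_nonneg w]
    have h2 := Complex.normSq_pos.2 (hne1 w hw)
    have h3 : (I * (1 + w) / (1 - w)).im = (1 - Complex.normSq w) / Complex.normSq (1 - w) := by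
      rw [Complex.div_im]
      simp [Complex.normSq_apply]
      field_simp
      ring
    rw [h3]
    exact div_pos (by linarith) h2
  obtain ⟨ν, hν⟩ := exists_probabilityMeasure_disc (G := fun w => -I * N (I * (1 + w) / (1 - w)))
    (by
      refine (hN.comp (t := {z | 0 < z.im}) ?_ fun w hw => him w hw).const_mul (-I)
      intro w hw
      have := hne1 w hw
      exact DifferentiableAt.differentiableWithinAt (by fun_prop (disch := assumption)))
    (by
      intro w hw
      have := hmaps (him w hw)
      simpa using le_of_lt this)
    (by simp [hI])
  -- The Cayley transform on the boundary. It is already real off `ζ = 1`; taking the real part only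
  -- makes it a total real function.
  set τ : sphere (0 : ℂ) 1 → ℝ := fun ζ => (I * (1 + (ζ : ℂ)) / (1 - (ζ : ℂ))).re with hτ
  have hτm : Measurable τ := by
    have : Measurable fun ζ : sphere (0 : ℂ) 1 => I * (1 + (ζ : ℂ)) / (1 - (ζ : ℂ)) := by
      fun_prop
    exact Complex.measurable_re.comp this
  set p : sphere (0 : ℂ) 1 := ⟨1, by simp⟩
  have hτv : ∀ ζ : sphere (0 : ℂ) 1, ζ ≠ p → (τ ζ : ℂ) = I * (1 + (ζ : ℂ)) / (1 - (ζ : ℂ)) := by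
    intro ζ hζ
    have h1 : 1 - (ζ : ℂ) ≠ 0 := by
      intro h; exact hζ (Subtype.ext (sub_eq_zero.1 h).symm)
    have h2 := Complex.normSq_pos.2 h1
    have h3 : Complex.normSq ζ = 1 := by
      rw [Complex.normSq_eq_norm_sq]
      have : ‖(ζ : ℂ)‖ = 1 := by simp
      rw [this, one_pow]
    apply Complex.ext
    · rfl
    · rw [Complex.ofReal_im]
      have : (I * (1 + (ζ : ℂ)) / (1 - (ζ : ℂ))).im =
          (1 - Complex.normSq ζ) / Complex.normSq (1 - (ζ : ℂ)) := by
        rw [Complex.div_im]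
        simp [Complex.normSq_apply]
        field_simp
        ring
      rw [this, h3]; simp
  set P : Measure (sphere (0 : ℂ) 1) := (ν : Measure (sphere (0 : ℂ) 1)) with hP
  -- The point `ζ = 1` corresponds to infinity, so its mass is the coefficient of the linear term;
  -- the rest is transported to the line.
  refine ⟨P.real {p}, (P.restrict {p}ᶜ).map τ, by positivity, inferInstance, ?_, ?_⟩
  · rw [map_measureReal_apply hτm .univ, preimage_univ, measureReal_restrict_apply .univ,
      univ_inter, measureReal_add_measureReal_compl (measurableSet_singleton p)]
    simp [hP]
  · intro z hz
    have hzI : z + I ≠ 0 := by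
      intro h
      have := congrArg Complex.im h
      simp at this
      linarith
    set w := (z - I) / (z + I) with hw
    have hw1 : w ∈ ball (0 : ℂ) 1 := by
      rw [mem_ball, dist_zero_right, hw, norm_div, div_lt_one (norm_pos_iff.2 hzI)]
      rw [← sq_lt_sq₀ (norm_nonneg _) (norm_nonneg _), ← Complex.normSq_eq_norm_sq,
        ← Complex.normSq_eq_norm_sq, Complex.normSq_apply, Complex.normSq_apply]
      simp
      nlinarith
    have h1w : 1 - w = 2 * I / (z + I) := by
      rw [hw, one_sub_div hzI]; ring
    have hwz : I * (1 + w) / (1 - w) = z := by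
      rw [h1w, hw, one_add_div hzI]
      field_simp
      ring
    have h1 := hν w hw1
    rw [hwz] at h1
    have hker : Continuous fun ζ : sphere (0 : ℂ) 1 => ((ζ : ℂ) + w) / ((ζ : ℂ) - w) := by
      refine Continuous.div (by fun_prop) (by fun_prop) fun ζ h => ?_
      have hζ := ζ.2
      rw [sub_eq_zero] at h
      simp [h] at hζ hw1
      linarith
    have hki : Integrable (fun ζ : sphere (0 : ℂ) 1 => ((ζ : ℂ) + w) / ((ζ : ℂ) - w)) P :=
      hker.integrable_of_hasCompactSupport (HasCompactSupport.of_compactSpace _)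
    have h2 : N z = I * ∫ ζ : sphere (0 : ℂ) 1, ((ζ : ℂ) + w) / ((ζ : ℂ) - w) ∂P := by
      rw [h1, ← mul_assoc]; simp
    rw [h2, ← integral_add_compl (measurableSet_singleton p) hki, integral_singleton, mul_add,
      integral_map hτm.aemeasurable
        (Measurable.aestronglyMeasurable (by fun_prop)), ← integral_const_mul]
    congr 1
    · rw [Complex.real_smul, ← hwz]
      simp only [p]
      ring
    · refine setIntegral_congr_fun (measurableSet_singleton p).compl fun ζ hζ => ?_
      have h1 : 1 - (ζ : ℂ) ≠ 0 := by
        intro h; exact hζ (Subtype.ext (sub_eq_zero.1 h).symm)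
      have h3 : (τ ζ : ℂ) - z ≠ 0 := by
        intro h
        have := congrArg Complex.im h
        simp at this
        linarith
      have h4 : (ζ : ℂ) - w ≠ 0 := by
        intro h
        have hζ := ζ.2
        rw [sub_eq_zero] at h
        simp [h] at hζ hw1
        linarith
      have e1 := hτv ζ hζ
      have e2 : (τ ζ : ℂ) * (1 - (ζ : ℂ)) = I * (1 + (ζ : ℂ)) := by
        rw [e1]; field_simp
      have e3 : w * (z + I) = z - I := by rw [hw]; field_simp
      rw [← mul_div_assoc, div_eq_div_iff h4 h3]
      apply mul_right_cancel₀ (mul_ne_zero h1 hzI)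
      clear_value w
      linear_combination (I * (ζ * (z + I) + w * (z + I)) - z * (ζ * (z + I) - w * (z + I))) * e2 +
        (I * (I * (1 + ζ) - z * (1 - ζ)) + (1 - ζ) + z * (I * (1 + ζ))) * e3 +
        (z * (1 - (ζ : ℂ)) ^ 2 - I * (1 + ζ) * (1 - ζ)) * I_sq
/-! ### Behaviour of Herglotz integrals along the imaginary axis -/

theorem ofReal_sub_ne_zero {z : ℂ} (hz : 0 < z.im) (t : ℝ) : (t : ℂ) - z ≠ 0 := by
  intro h
  have := congrArg Complex.im h
  simp at this
  linarith

theorem im_le_norm_ofReal_sub {z : ℂ} (t : ℝ) : z.im ≤ ‖(t : ℂ) - z‖ := by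
  have := Complex.abs_im_le_norm ((t : ℂ) - z)
  simp only [Complex.sub_im, Complex.ofReal_im, zero_sub, abs_neg] at this
  exact (le_abs_self _).trans this

theorem integrable_kernel (ρ : Measure ℝ) [IsFiniteMeasure ρ] {z : ℂ} (hz : 0 < z.im) :
    Integrable (fun t : ℝ => (1 + t * z) / ((t : ℂ) - z)) ρ := by
  refine Integrable.of_bound (Measurable.aestronglyMeasurable (by fun_prop))
    (‖z‖ + ‖1 + z ^ 2‖ / z.im) (ae_of_all _ fun t => ?_)
  have h1 : (1 + t * z) / ((t : ℂ) - z) = z + (1 + z ^ 2) / (t - z) := by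
    have := ofReal_sub_ne_zero hz t
    field_simp
    ring
  rw [h1]
  refine (norm_add_le _ _).trans (add_le_add_right ?_ _)
  rw [norm_div]
  exact div_le_div_of_nonneg_left (norm_nonneg _) hz (im_le_norm_ofReal_sub t)

theorem im_kernel (t : ℝ) {y : ℝ} (hy : 0 < y) :
    ((1 + t * (y * I)) / ((t : ℂ) - y * I)).im = y * ((1 + t ^ 2) / (t ^ 2 + y ^ 2)) := by
  have : t ^ 2 + y ^ 2 ≠ 0 := by positivity
  rw [Complex.div_im]
  simp [Complex.normSq_apply]
  field_simp
  ring

theorem im_integral_kernel (ρ : Measure ℝ) [IsFiniteMeasure ρ] {y : ℝ} (hy : 0 < y) :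
    (∫ t : ℝ, (1 + t * (y * I)) / ((t : ℂ) - y * I) ∂ρ).im =
      y * ∫ t : ℝ, (1 + t ^ 2) / (t ^ 2 + y ^ 2) ∂ρ := by
  have h := integrable_kernel ρ (z := y * I) (by simpa using hy)
  have h2 := integral_im h
  simp only [RCLike.im_eq_complex_im] at h2
  rw [← h2, ← integral_const_mul]
  exact integral_congr_ae (ae_of_all _ fun t => im_kernel t hy)

theorem weight_le_one (t : ℝ) {y : ℝ} (hy : 1 ≤ y) : (1 + t ^ 2) / (t ^ 2 + y ^ 2) ≤ 1 := by
  rw [div_le_one (by positivity)]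
  nlinarith

theorem measurable_weight (y : ℝ) : Measurable fun t : ℝ => (1 + t ^ 2) / (t ^ 2 + y ^ 2) := by
  fun_prop

theorem integrable_weight (ρ : Measure ℝ) [IsFiniteMeasure ρ] {y : ℝ} (hy : 1 ≤ y) :
    Integrable (fun t : ℝ => (1 + t ^ 2) / (t ^ 2 + y ^ 2)) ρ :=
  Integrable.of_bound (measurable_weight y).aestronglyMeasurable 1 (ae_of_all _ fun t => by
    rw [Real.norm_of_nonneg (by positivity)]; exact weight_le_one t hy)

theorem one_le_natCast_add_one (n : ℕ) : (1 : ℝ) ≤ n + 1 := by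
  have : (0 : ℝ) ≤ n := n.cast_nonneg
  linarith

theorem tendsto_natCast_add_one : Tendsto (fun n : ℕ => (n : ℝ) + 1) atTop atTop :=
  tendsto_atTop_add_const_right _ _ tendsto_natCast_atTop_atTop

/-- Dominated convergence, the weights being at most 1. By `im_integral_kernel` this says that the
Herglotz integral satisfies `Im M(iy)/y → 0`. -/
theorem tendsto_integral_weight (ρ : Measure ℝ) [IsFiniteMeasure ρ] :
    Tendsto (fun n : ℕ => ∫ t : ℝ, (1 + t ^ 2) / (t ^ 2 + ((n : ℝ) + 1) ^ 2) ∂ρ) atTop (𝓝 0) := by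
  have h := tendsto_integral_of_dominated_convergence (μ := ρ)
    (F := fun (n : ℕ) (t : ℝ) => (1 + t ^ 2) / (t ^ 2 + ((n : ℝ) + 1) ^ 2)) (f := fun _ => 0)
    (fun _ => 1) (fun n => (measurable_weight _).aestronglyMeasurable) (integrable_const _)
    (fun n => ae_of_all _ fun t => by
      rw [Real.norm_of_nonneg (by positivity)]; exact weight_le_one t (one_le_natCast_add_one n))
    (ae_of_all _ fun t => by
      refine Tendsto.div_atTop tendsto_const_nhds ?_
      exact tendsto_atTop_add_const_left _ _
        ((tendsto_pow_atTop two_ne_zero).comp tendsto_natCast_add_one))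
  simpa using h

/-- Monotone convergence: `y²(1 + t²)/(t² + y²)` increases to `1 + t²`. Hence `y Im M(iy)` tends to
the total mass of `(1 + t²) dρ`. -/
theorem tendsto_sq_mul_integral_weight (ρ : Measure ℝ) [IsFiniteMeasure ρ]
    (hρ : ∫⁻ t : ℝ, ENNReal.ofReal (1 + t ^ 2) ∂ρ = ∞) :
    Tendsto (fun n : ℕ => ((n : ℝ) + 1) ^ 2 *
      ∫ t : ℝ, (1 + t ^ 2) / (t ^ 2 + ((n : ℝ) + 1) ^ 2) ∂ρ) atTop atTop := by
  have h := lintegral_tendsto_of_tendsto_of_monotone (μ := ρ)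
    (f := fun (n : ℕ) (t : ℝ) =>
      ENNReal.ofReal (((n : ℝ) + 1) ^ 2 * ((1 + t ^ 2) / (t ^ 2 + ((n : ℝ) + 1) ^ 2))))
    (F := fun t => ENNReal.ofReal (1 + t ^ 2)) (fun n => by fun_prop)
    (ae_of_all _ fun t m n hmn => by
      refine ENNReal.ofReal_le_ofReal ?_
      rw [← mul_div_assoc, ← mul_div_assoc, div_le_div_iff₀ (by positivity) (by positivity)]
      have h1 : ((m : ℝ) + 1) ^ 2 ≤ ((n : ℝ) + 1) ^ 2 := by gcongr
      have h2 : 0 ≤ (1 + t ^ 2) * t ^ 2 := by positivity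
      nlinarith [mul_le_mul_of_nonneg_left h1 h2])
    (ae_of_all _ fun t => by
      refine ENNReal.tendsto_ofReal ?_
      have h0 : Tendsto (fun n : ℕ => t ^ 2 / (((n : ℝ) + 1) ^ 2)) atTop (𝓝 0) :=
        Tendsto.div_atTop tendsto_const_nhds
          ((tendsto_pow_atTop two_ne_zero).comp tendsto_natCast_add_one)
      have h1 : Tendsto (fun n : ℕ => (1 + t ^ 2) / (t ^ 2 / (((n : ℝ) + 1) ^ 2) + 1)) atTop
          (𝓝 ((1 + t ^ 2) / (0 + 1))) :=
        tendsto_const_nhds.div (h0.add_const 1) (by norm_num)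
      rw [zero_add, div_one] at h1
      refine h1.congr fun n => ?_
      have := one_le_natCast_add_one n
      field_simp)
  rw [hρ] at h
  rw [← ENNReal.tendsto_ofReal_nhds_top]
  refine h.congr fun n => ?_
  have hn := one_le_natCast_add_one n
  rw [← integral_const_mul, ofReal_integral_eq_lintegral_ofReal]
  · exact (integrable_weight ρ hn).const_mul _
  · exact ae_of_all _ fun t => by positivity

/-! ### The Donoghue class in terms of finite measures -/

theorem kernel_eq {z : ℂ} (hz : 0 < z.im) (t : ℝ) :
    1 / ((t : ℂ) - z) - (t : ℂ) / (1 + (t : ℂ) ^ 2) =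
      ((1 / (1 + t ^ 2) : ℝ) : ℂ) * ((1 + t * z) / ((t : ℂ) - z)) := by
  have h1 := ofReal_sub_ne_zero hz t
  have h2 : (1 + (t : ℂ) ^ 2) ≠ 0 := by
    have : (1 + t ^ 2 : ℝ) ≠ 0 := by positivity
    exact_mod_cast this
  push_cast
  field_simp
  ring

/-- The substitution `dρ = dμ/(1 + t²)` turns the normalization of `μ` into `ρ(ℝ) = 1`, and `μ(ℝ) =
∞` into the divergence of `∫ (1 + t²) dρ`. -/
theorem exists_finite_of_isDonoghue {M : ℂ → ℂ} (hM : IsDonoghue M) :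
    ∃ ρ : Measure ℝ, IsProbabilityMeasure ρ ∧ ∫⁻ t : ℝ, ENNReal.ofReal (1 + t ^ 2) ∂ρ = ∞ ∧
      ∀ z : ℂ, 0 < z.im → M z = ∫ t : ℝ, (1 + t * z) / ((t : ℂ) - z) ∂ρ := by
  obtain ⟨μ, hμ, h1, hrep⟩ := hM.representation
  have hm : Measurable fun t : ℝ => ENNReal.ofReal (1 / (1 + t ^ 2)) := by fun_prop
  refine ⟨μ.withDensity fun t => ENNReal.ofReal (1 / (1 + t ^ 2)), ⟨?_⟩, ?_, fun z hz => ?_⟩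
  · rw [withDensity_apply _ .univ, Measure.restrict_univ, h1]
  · rw [lintegral_withDensity_eq_lintegral_mul _ hm (by fun_prop), ← hμ, ← lintegral_one]
    refine lintegral_congr fun t => ?_
    rw [Pi.mul_apply, ← ENNReal.ofReal_mul (by positivity), one_div_mul_cancel (by positivity),
      ENNReal.ofReal_one]
  · rw [hrep z hz, integral_withDensity_eq_integral_toReal_smul hm (by simp)]
    refine integral_congr_ae (ae_of_all _ fun t => ?_)
    simp only
    rw [kernel_eq hz, ENNReal.toReal_ofReal (by positivity), Complex.real_smul]

theorem isDonoghue_of_finite {M : ℂ → ℂ} (hd : DifferentiableOn ℂ M {z | 0 < z.im})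
    (hmaps : MapsTo M {z | 0 < z.im} {z | 0 < z.im}) (ρ : Measure ℝ) [IsProbabilityMeasure ρ]
    (hρ : ∫⁻ t : ℝ, ENNReal.ofReal (1 + t ^ 2) ∂ρ = ∞)
    (hrep : ∀ z : ℂ, 0 < z.im → M z = ∫ t : ℝ, (1 + t * z) / ((t : ℂ) - z) ∂ρ) :
    IsDonoghue M := by
  have hm : Measurable fun t : ℝ => ENNReal.ofReal (1 + t ^ 2) := by fun_prop
  refine ⟨hd, hmaps, ρ.withDensity fun t => ENNReal.ofReal (1 + t ^ 2), ?_, ?_, fun z hz => ?_⟩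
  · rw [withDensity_apply _ .univ, Measure.restrict_univ, hρ]
  · rw [lintegral_withDensity_eq_lintegral_mul _ hm (by fun_prop)]
    have : ∫⁻ _ : ℝ, 1 ∂ρ = 1 := by simp
    rw [← this]
    refine lintegral_congr fun t => ?_
    rw [Pi.mul_apply, ← ENNReal.ofReal_mul (by positivity), mul_one_div_cancel (by positivity),
      ENNReal.ofReal_one]
  · rw [hrep z hz, integral_withDensity_eq_integral_toReal_smul hm (by simp)]
    refine integral_congr_ae (ae_of_all _ fun t => ?_)
    simp only
    rw [kernel_eq hz, ENNReal.toReal_ofReal (by positivity), Complex.real_smul, ← mul_assoc,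
      ← Complex.ofReal_mul, mul_one_div_cancel (by positivity), Complex.ofReal_one, one_mul]

theorem apply_I_of_isDonoghue {M : ℂ → ℂ} (hM : IsDonoghue M) : M I = I := by
  obtain ⟨ρ, hρ, -, hrep⟩ := exists_finite_of_isDonoghue hM
  rw [hrep I (by simp)]
  have : ∀ t : ℝ, (1 + t * I) / ((t : ℂ) - I) = I := fun t => by
    rw [div_eq_iff (ofReal_sub_ne_zero (by simp) t), mul_sub, I_mul_I]
    ring
  simp [this]

/-- Because `(1 + tz)/(t - z) = -t + (1 + t²)/(t - z)` and `|t - iy| ≥ y`. A finite second moment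
thus forces a real limit along the imaginary axis, with error `O(1/y)`. -/
theorem norm_integral_kernel_add_le (ρ : Measure ℝ) [IsFiniteMeasure ρ]
    (hρ : Integrable (fun t : ℝ => 1 + t ^ 2) ρ) {y : ℝ} (hy : 0 < y) :
    ‖(∫ t : ℝ, (1 + t * (y * I)) / ((t : ℂ) - y * I) ∂ρ) - ((-∫ t : ℝ, t ∂ρ : ℝ) : ℂ)‖ ≤
      (∫ t : ℝ, 1 + t ^ 2 ∂ρ) / y := by
  have hz : 0 < ((y : ℂ) * I).im := by simpa using hy
  have ht : Integrable (fun t : ℝ => (t : ℂ)) ρ := by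
    refine (hρ.mono' (f := fun t => t) (by fun_prop) (ae_of_all _ fun t => ?_)).ofReal
    rw [Real.norm_eq_abs]
    nlinarith [sq_abs t, sq_nonneg (|t| - 1), abs_nonneg t]
  have h1 : (∫ t : ℝ, (1 + t * (y * I)) / ((t : ℂ) - y * I) ∂ρ) - ((-∫ t : ℝ, t ∂ρ : ℝ) : ℂ) =
      ∫ t : ℝ, ((1 + t ^ 2 : ℝ) : ℂ) / ((t : ℂ) - y * I) ∂ρ := by
    rw [Complex.ofReal_neg, sub_neg_eq_add, ← integral_complex_ofReal,
      ← integral_add (integrable_kernel ρ hz) ht]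
    refine integral_congr_ae (ae_of_all _ fun t => ?_)
    have := ofReal_sub_ne_zero hz t
    simp only
    push_cast
    field_simp
    ring
  rw [h1, ← integral_div]
  refine norm_integral_le_of_norm_le (hρ.div_const y) (ae_of_all _ fun t => ?_)
  rw [norm_div, Complex.norm_real, Real.norm_of_nonneg (by positivity)]
  have := im_le_norm_ofReal_sub (z := y * I) t
  exact div_le_div_of_nonneg_left (by positivity) hy (by simpa using this)

/-! ### Rotations of functions of the Donoghue class -/

/-- A real Möbius map of determinant `s² + c² = 1` scales imaginary parts by the inverse square
modulus of its denominator. -/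
theorem im_mul_normSq_of_rotation {c s : ℝ} (hcs : c ^ 2 + s ^ 2 = 1) {M N : ℂ}
    (h : N * (s - c * M) = c + s * M) : N.im * normSq (s - c * M) = M.im := by
  have h1 : N * (normSq (s - c * M) : ℂ) = (c + s * M) * (starRingEnd ℂ) (s - c * M) := by
    rw [← h, mul_assoc, Complex.mul_conj]
  have h2 := congrArg Complex.im h1
  rw [Complex.im_mul_ofReal] at h2
  rw [h2]
  simp
  linear_combination M.im * hcs

/-- Numerator and denominator cannot vanish together: `s(s - cM) + c(c + sM) = 1`. -/
theorem sub_mul_ne_zero_of_rotation {c s : ℝ} (hcs : c ^ 2 + s ^ 2 = 1) {M N : ℂ}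
    (h : N * (s - c * M) = c + s * M) : (s - c * M : ℂ) ≠ 0 := by
  intro h0
  rw [h0, mul_zero] at h
  have hcs' : (c : ℂ) ^ 2 + (s : ℂ) ^ 2 = 1 := by exact_mod_cast hcs
  have : (1 : ℂ) = 0 := by linear_combination s * h0 - c * h - hcs'
  exact one_ne_zero this

/-- The inverse rotation is obtained by `c ↦ -c`, so each estimate for `N` in terms of `M` can be
reversed. -/
theorem rotation_symm {c s : ℝ} {M N : ℂ} (h : N * (s - c * M) = c + s * M) :
    M * (s - (-c : ℝ) * N) = (-c : ℝ) + s * N := by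
  push_cast
  linear_combination -h

theorem isDonoghue_congr {M N : ℂ → ℂ} (hM : IsDonoghue M) (h : ∀ z : ℂ, 0 < z.im → N z = M z) :
    IsDonoghue N := by
  obtain ⟨μ, h1, h2, h3⟩ := hM.representation
  exact ⟨hM.analytic.congr fun z hz => h z hz, hM.mapsTo.congr fun z hz => (h z hz).symm,
    μ, h1, h2, fun z hz => (h z hz).trans (h3 z hz)⟩

/-- The Donoghue class is invariant under the rotations of the upper half-plane about `I`. -/
theorem isDonoghue_of_rotation {c s : ℝ} (hcs : c ^ 2 + s ^ 2 = 1) {M N : ℂ → ℂ}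
    (hM : IsDonoghue M)
    (h : ∀ z : ℂ, 0 < z.im → N z * (s - c * M z) = c + s * M z) : IsDonoghue N := by
  rcases eq_or_ne c 0 with hc | hc
  · refine isDonoghue_congr hM fun z hz => ?_
    have h1 := h z hz
    have hs : (s : ℂ) ≠ 0 := by
      rintro h0
      have : s = 0 := by exact_mod_cast h0
      rw [hc, this] at hcs
      norm_num at hcs
    simp only [hc, Complex.ofReal_zero, zero_mul, sub_zero, zero_add] at h1
    rw [mul_comm] at h1
    exact mul_left_cancel₀ hs h1
  have hd : ∀ z : ℂ, 0 < z.im → (s - c * M z : ℂ) ≠ 0 := fun z hz =>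
    sub_mul_ne_zero_of_rotation hcs (h z hz)
  have hNd : DifferentiableOn ℂ N {z | 0 < z.im} := by
    have h1 : DifferentiableOn ℂ (fun z => (c + s * M z) / (s - c * M z)) {z | 0 < z.im} :=
      ((hM.analytic.const_mul _).const_add _).div ((hM.analytic.const_mul _).const_sub _) hd
    exact h1.congr fun z hz => (eq_div_iff (hd z hz)).2 (h z hz)
  have hNm : MapsTo N {z | 0 < z.im} {z | 0 < z.im} := by
    intro z hz
    have h1 := im_mul_normSq_of_rotation hcs (h z hz)
    have h2 : 0 < (M z).im := hM.mapsTo hz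
    rw [← h1] at h2
    exact pos_of_mul_pos_left h2 (normSq_nonneg _)
  have hNI : N I = I := by
    have h1 := h I (by simp)
    have h2 := hd I (by simp)
    rw [apply_I_of_isDonoghue hM] at h1 h2
    refine mul_right_cancel₀ h2 (h1.trans ?_)
    linear_combination (c : ℂ) * I_mul_I
  obtain ⟨σ, hσ, hσinf, hMrep⟩ := exists_finite_of_isDonoghue hM
  obtain ⟨b, ρ, hb, hρ, hmass, hNrep⟩ := exists_measure_upperHalfPlane hNd hNm hNI
  have hy1 := one_le_natCast_add_one
  set y : ℕ → ℝ := fun n => (n : ℝ) + 1 with hy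
  have hy0 : ∀ n, 0 < y n := fun n => one_pos.trans_le (hy1 n)
  have hz : ∀ n, 0 < ((y n : ℂ) * I).im := fun n => by simpa using hy0 n
  set A : ℕ → ℝ := fun n => ∫ t : ℝ, (1 + t ^ 2) / (t ^ 2 + y n ^ 2) ∂σ with hA
  set B : ℕ → ℝ := fun n => ∫ t : ℝ, (1 + t ^ 2) / (t ^ 2 + y n ^ 2) ∂ρ with hB
  have hA0 : Tendsto A atTop (𝓝 0) := tendsto_integral_weight σ
  have hAinf : Tendsto (fun n => y n ^ 2 * A n) atTop atTop :=
    tendsto_sq_mul_integral_weight σ hσinf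
  have hMim : ∀ n, (M (y n * I)).im = y n * A n := fun n => by
    rw [hMrep _ (hz n), im_integral_kernel σ (hy0 n)]
  have hNim : ∀ n, (N (y n * I)).im = y n * (b + B n) := fun n => by
    rw [hNrep _ (hz n), Complex.add_im, im_integral_kernel ρ (hy0 n)]
    simp
    ring
  have hMpos : ∀ n, 0 < (M (y n * I)).im := fun n => hM.mapsTo (hz n)
  have hBnn : ∀ n, 0 ≤ B n := fun n => integral_nonneg fun t => by positivity
  -- If `b > 0` then `Im N(iy) ≥ by`, while `|s - cM| ≥ |c| Im M` gives `c² Im N · Im M ≤ 1`.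
  -- Together they bound `y²A` by `1/(bc²)`, against `y²A → ∞`.
  have hb0 : b = 0 := by
    by_contra hne
    have hbpos : 0 < b := lt_of_le_of_ne hb (Ne.symm hne)
    obtain ⟨n, hn⟩ := (hAinf.eventually_gt_atTop (1 / (b * c ^ 2))).exists
    rw [div_lt_iff₀ (by positivity)] at hn
    have h1 := im_mul_normSq_of_rotation hcs (h _ (hz n))
    have h2 : c ^ 2 * (M (y n * I)).im ^ 2 ≤ normSq (s - c * M (y n * I)) := by
      rw [Complex.normSq_apply]
      simp
      nlinarith [sq_nonneg (s - c * (M (y n * I)).re)]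
    have h3 : (N (y n * I)).im * (c ^ 2 * (M (y n * I)).im ^ 2) ≤ (M (y n * I)).im := by
      calc _ ≤ _ := mul_le_mul_of_nonneg_left h2 (le_of_lt (hNm (hz n)))
        _ = _ := h1
    have h4 : (N (y n * I)).im * (c ^ 2 * (M (y n * I)).im) ≤ 1 := by
      refine le_of_mul_le_mul_right ?_ (hMpos n)
      linarith
    have h5 : y n * b ≤ (N (y n * I)).im := by
      rw [hNim]
      exact mul_le_mul_of_nonneg_left (by linarith [hBnn n]) (hy0 n).le
    have h6 : y n * b * (c ^ 2 * (M (y n * I)).im) ≤ 1 :=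
      (mul_le_mul_of_nonneg_right h5 (by have := hMpos n; positivity)).trans h4
    rw [hMim] at h6
    nlinarith
  subst hb0
  have hprob : IsProbabilityMeasure ρ := ⟨by
    rw [← ENNReal.ofReal_toReal (measure_ne_top ρ univ), ← measureReal_def]
    rw [zero_add] at hmass
    rw [hmass, ENNReal.ofReal_one]⟩
  have hNrep' : ∀ z : ℂ, 0 < z.im → N z = ∫ t : ℝ, (1 + t * z) / ((t : ℂ) - z) ∂ρ := by
    intro z hz
    rw [hNrep z hz, Complex.ofReal_zero, zero_mul, zero_add]
  refine isDonoghue_of_finite hNd hNm ρ ?_ hNrep'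
  -- With finite mass `m`, `N(iy)` tends to a real `q` and `1 ≤ y²B ≤ m`; both are tested against
  -- `Im M · |s + cN|² = Im N`.
  by_contra hfin
  have hint : Integrable (fun t : ℝ => 1 + t ^ 2) ρ := by
    refine ⟨Measurable.aestronglyMeasurable (by fun_prop), ?_⟩
    rw [hasFiniteIntegral_iff_ofReal (ae_of_all _ fun t => by positivity)]
    exact lt_top_iff_ne_top.2 hfin
  set m := ∫ t : ℝ, 1 + t ^ 2 ∂ρ with hm
  set q : ℝ := -∫ t : ℝ, t ∂ρ with hq
  have hNq : ∀ n, ‖N (y n * I) - q‖ ≤ m / y n := fun n => by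
    rw [hNrep' _ (hz n)]
    exact norm_integral_kernel_add_le ρ hint (hy0 n)
  have hBle : ∀ n, y n ^ 2 * B n ≤ m := fun n => by
    rw [hB, ← integral_const_mul]
    refine integral_mono ((integrable_weight ρ (hy1 n)).const_mul _) hint fun t => ?_
    have h1 : 0 < y n := hy0 n
    simp only
    rw [← mul_div_assoc, div_le_iff₀ (by positivity)]
    nlinarith [mul_nonneg (sq_nonneg t) (by positivity : 0 ≤ 1 + t ^ 2)]
  have hBge : ∀ n, 1 ≤ y n ^ 2 * B n := fun n => by
    rw [hB, ← integral_const_mul]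
    have h1 : ∫ _ : ℝ, (1 : ℝ) ∂ρ = 1 := by simp
    refine h1.symm.trans_le (integral_mono (integrable_const _)
      ((integrable_weight ρ (hy1 n)).const_mul _) fun t => ?_)
    have h1 : 0 < y n := hy0 n
    simp only
    rw [← mul_div_assoc, le_div_iff₀ (by positivity)]
    have h2 : 1 ≤ y n ^ 2 := one_le_pow₀ (hy1 n)
    nlinarith [mul_le_mul_of_nonneg_right h2 (sq_nonneg t)]
  have hinv : ∀ n, (M (y n * I)).im * normSq (s + c * N (y n * I)) = (N (y n * I)).im := fun n => by
    have := im_mul_normSq_of_rotation (c := -c) (by linarith [hcs, neg_sq c])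
      (rotation_symm (h _ (hz n)))
    simpa using this
  simp only [hMim, hNim, zero_add] at hinv
  -- If `s + cq = 0`, then `|s + cN|² ≤ c²m²/y²`, so `y²B ≤ c²m²A → 0`, against `y²B ≥ 1`. Otherwise
  -- `|s + cN|²` stays away from 0 and `y²A` is bounded by a multiple of `m`, against `y²A → ∞`.
  rcases eq_or_ne (s + c * q) 0 with h0 | h0
  · obtain ⟨n, hn⟩ := (hA0.const_mul (c ^ 2 * m ^ 2)).eventually
      (gt_mem_nhds (b := c ^ 2 * m ^ 2 * 0) (a := 1) (by simp)) |>.exists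
    have h1 : (s + c * N (y n * I) : ℂ) = c * (N (y n * I) - q) := by
      have : (s : ℂ) + c * q = 0 := by exact_mod_cast h0
      linear_combination this
    have h2 : normSq (s + c * N (y n * I)) ≤ c ^ 2 * (m / y n) ^ 2 := by
      rw [h1, normSq_mul, normSq_ofReal, Complex.normSq_eq_norm_sq, ← sq]
      gcongr
      exact hNq n
    have hAn : 0 ≤ y n * A n := by rw [← hMim]; exact (hMpos n).le
    have h3 : y n * B n ≤ y n * A n * (c ^ 2 * (m / y n) ^ 2) := by
      rw [← hinv n]
      exact mul_le_mul_of_nonneg_left h2 hAn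
    have h4 : y n * (y n * A n * (c ^ 2 * (m / y n) ^ 2)) = c ^ 2 * m ^ 2 * A n := by
      have := (hy0 n).ne'
      field_simp
    have h5 := mul_le_mul_of_nonneg_left h3 (hy0 n).le
    rw [h4] at h5
    have := hBge n
    nlinarith
  · have hlim : Tendsto (fun n => N (y n * I)) atTop (𝓝 (q : ℂ)) := by
      rw [tendsto_iff_norm_sub_tendsto_zero]
      exact squeeze_zero (fun n => norm_nonneg _) hNq
        (tendsto_const_nhds.div_atTop tendsto_natCast_add_one)
    have hlim2 : Tendsto (fun n => normSq (s + c * N (y n * I))) atTop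
        (𝓝 (normSq (s + c * q : ℂ))) :=
      (Complex.continuous_normSq.tendsto _).comp ((hlim.const_mul _).const_add _)
    have hκ : 0 < normSq (s + c * q : ℂ) := by
      rw [Complex.normSq_pos]
      exact_mod_cast h0
    set κ := normSq (s + c * q : ℂ)
    obtain ⟨n, hn1, hn2⟩ := ((hlim2.eventually (lt_mem_nhds (half_lt_self hκ))).and
      (hAinf.eventually_gt_atTop (m / (κ / 2)))).exists
    rw [div_lt_iff₀ (by positivity)] at hn2
    have hAn : 0 ≤ y n * A n := by rw [← hMim]; exact (hMpos n).le
    have h1 : y n * A n * (κ / 2) ≤ y n * B n := by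
      rw [← hinv n]
      exact mul_le_mul_of_nonneg_left hn1.le hAn
    have h2 := mul_le_mul_of_nonneg_left h1 (hy0 n).le
    have := hBle n
    nlinarith

end Herglotz

namespace Rigged

variable {H : Type*} [NormedAddCommGroup H] [InnerProductSpace ℂ H]

/-! ### Self-adjoint operators -/

theorem le_norm_of_im_inner {x y : H} {k : ℝ} (h : k * ‖x‖ ^ 2 ≤ |(⟪x, y⟫_ℂ).im|) :
    k * ‖x‖ ≤ ‖y‖ := by
  rcases eq_or_ne x 0 with rfl | hx
  · simp
  · have h1 : 0 < ‖x‖ := norm_pos_iff.2 hx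
    have h2 := (h.trans (Complex.abs_im_le_norm _)).trans (norm_inner_le_norm x y)
    refine le_of_mul_le_mul_right ?_ h1
    nlinarith

theorem im_inner_sub_smul (x y : H) (z : ℂ) :
    (⟪x, y - z • x⟫_ℂ).im = (⟪x, y⟫_ℂ).im - z.im * ‖x‖ ^ 2 := by
  rw [inner_sub_right, inner_smul_right, inner_self_eq_norm_sq_to_K, Complex.sub_im]
  congr 1
  exact Complex.im_mul_ofReal z (‖x‖ ^ 2) ▸ by push_cast; rfl

theorem im_inner_eq_zero_of_symmetric {S : H →ₗ.[ℂ] H} (hS : S.IsFormalAdjoint S) (x : S.domain) :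
    (⟪(x : H), S x⟫_ℂ).im = 0 := by
  rw [← Complex.conj_eq_iff_im, inner_conj_symm]
  exact hS x x

theorem abs_im_mul_norm_le_of_symmetric {S : H →ₗ.[ℂ] H} (hS : S.IsFormalAdjoint S) (z : ℂ)
    (x : S.domain) : |z.im| * ‖(x : H)‖ ≤ ‖S x - z • (x : H)‖ := by
  refine le_norm_of_im_inner ?_
  rw [im_inner_sub_smul, im_inner_eq_zero_of_symmetric hS, zero_sub, abs_neg, abs_mul,
    abs_of_nonneg (sq_nonneg ‖(x : H)‖)]

variable [CompleteSpace H]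

theorem isFormalAdjoint_of_isSelfAdjoint {S : H →ₗ.[ℂ] H} (hS : IsSelfAdjoint S) :
    S.IsFormalAdjoint S := by
  have h := LinearPMap.adjoint_isFormalAdjoint hS.dense_domain
  rwa [LinearPMap.isSelfAdjoint_def.1 hS] at h

/-- For self-adjoint `S` and non-real `z`, the operator `S - zI` is onto. -/
theorem exists_sub_smul_eq_of_isSelfAdjoint {S : H →ₗ.[ℂ] H} (hS : IsSelfAdjoint S) {z : ℂ}
    (hz : z.im ≠ 0) (h : H) : ∃ x : S.domain, S x - z • (x : H) = h := by
  have hsym := isFormalAdjoint_of_isSelfAdjoint hS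
  -- On the closed graph, a complete space, `S - z` becomes a bounded operator that is bounded
  -- below, so its range is closed.
  let L : S.graph →L[ℂ] H :=
    (ContinuousLinearMap.snd ℂ H H - z • ContinuousLinearMap.fst ℂ H H).comp S.graph.subtypeL
  have hL : ∀ p : S.graph, L p = (p : H × H).2 - z • (p : H × H).1 := fun p => rfl
  have hzpos : 0 < |z.im| := abs_pos.2 hz
  have hfst : ∀ p : S.graph, ‖(p : H × H).1‖ ≤ ‖L p‖ / |z.im| := by
    rintro ⟨p, hp⟩
    obtain ⟨x, hx1, hx2⟩ := (LinearPMap.mem_graph_iff S).1 hp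
    rw [le_div_iff₀' hzpos, hL, ← hx1, ← hx2]
    exact abs_im_mul_norm_le_of_symmetric hsym z x
  have hanti : ∃ K, AntilipschitzWith K L := by
    refine ⟨NNReal.mk (max (1 / |z.im|) (1 + ‖z‖ / |z.im|)) (by positivity),
      ContinuousLinearMap.antilipschitz_of_bound _ fun p => ?_⟩
    have h1 := hfst p
    have h2 : ‖(p : H × H).2‖ ≤ ‖L p‖ + ‖z‖ * ‖(p : H × H).1‖ := by
      have h3 : (p : H × H).2 = L p + z • (p : H × H).1 := by rw [hL]; abel
      calc ‖(p : H × H).2‖ = ‖L p + z • (p : H × H).1‖ := by rw [← h3]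
        _ ≤ _ := (norm_add_le _ _).trans_eq (by rw [norm_smul])
    rw [NNReal.coe_mk]
    change ‖(p : H × H)‖ ≤ _
    rw [Prod.norm_def]
    refine max_le ?_ ?_
    · refine h1.trans ?_
      rw [div_eq_inv_mul, ← one_div]
      exact mul_le_mul_of_nonneg_right (le_max_left _ _) (norm_nonneg _)
    · calc _ ≤ ‖L p‖ + ‖z‖ * (‖L p‖ / |z.im|) :=
            h2.trans (add_le_add_right (mul_le_mul_of_nonneg_left h1 (norm_nonneg _)) _)
        _ = (1 + ‖z‖ / |z.im|) * ‖L p‖ := by ring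
        _ ≤ _ := mul_le_mul_of_nonneg_right (le_max_right _ _) (norm_nonneg _)
  obtain ⟨K, hK⟩ := hanti
  have hcg : IsClosed (S.graph : Set (H × H)) := hS.isClosed
  have hcs : CompleteSpace S.graph := hcg.completeSpace_coe
  have hclosed : IsClosed (L.range : Set H) := by
    exact hK.isClosed_range L.uniformContinuous
  have hcomp : CompleteSpace L.range := hclosed.completeSpace_coe
  -- A vector `w` orthogonal to the range satisfies `S*w = z̄w`; since `S* = S` is symmetric and
  -- `z̄` is non-real, `w = 0`.
  have hperp : L.rangeᗮ = ⊥ := by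
    rw [Submodule.eq_bot_iff]
    intro w hw
    have h1 : ∀ x : S.domain, ⟪(starRingEnd ℂ) z • w, (x : H)⟫_ℂ = ⟪w, S x⟫_ℂ := by
      intro x
      have h2 := (Submodule.mem_orthogonal' _ _).1 hw (L ⟨_, S.mem_graph x⟩) ⟨_, rfl⟩
      rw [hL] at h2
      simp only [inner_sub_right, inner_smul_right, sub_eq_zero] at h2
      rw [inner_smul_left, Complex.conj_conj, h2]
    have hdom : w ∈ S.adjoint.domain := LinearPMap.mem_adjoint_domain_of_exists _ ⟨_, h1⟩
    have hval : S.adjoint ⟨w, hdom⟩ = (starRingEnd ℂ) z • w :=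
      LinearPMap.adjoint_apply_eq hS.dense_domain _ h1
    have hgr : (w, (starRingEnd ℂ) z • w) ∈ S.graph := by
      rw [← LinearPMap.isSelfAdjoint_def.1 hS, ← hval]
      exact S.adjoint.mem_graph ⟨w, hdom⟩
    obtain ⟨x, hx1, hx2⟩ := (LinearPMap.mem_graph_iff S).1 hgr
    have h3 := abs_im_mul_norm_le_of_symmetric hsym ((starRingEnd ℂ) z) x
    simp only at hx1 hx2
    rw [hx2, hx1, sub_self, norm_zero, Complex.conj_im, abs_neg] at h3
    have h4 : ‖w‖ = 0 := le_antisymm (by nlinarith [norm_nonneg w]) (norm_nonneg w)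
    exact norm_eq_zero.1 h4
  have htop : L.range = ⊤ := (Submodule.orthogonal_eq_bot_iff).1 hperp
  have hmem : h ∈ L.range := htop ▸ Submodule.mem_top
  obtain ⟨⟨p, hp⟩, hp'⟩ := hmem
  obtain ⟨x, hx1, hx2⟩ := (LinearPMap.mem_graph_iff S).1 hp
  refine ⟨x, ?_⟩
  rw [hx1, hx2]
  exact hp'

/-! ### Bi-extensions -/

variable {A : H →ₗ.[ℂ] H}

theorem inclPlus_injective : Function.Injective (inclPlus A) := fun _ _ h => Subtype.ext h

theorem dense_adjoint_domain (hA : IsAdmissible A) : Dense (A.adjoint.domain : Set H) :=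
  hA.dense.mono (LinearPMap.IsFormalAdjoint.le_adjoint hA.dense hA.symmetric).1

theorem inclMinus_injective (hA : IsAdmissible A) : Function.Injective (inclMinus A) := by
  rw [injective_iff_map_eq_zero]
  intro h hh
  refine (dense_adjoint_domain hA).eq_zero_of_inner_right ℂ fun v hv => ?_
  have := congrArg (fun F : HMinus A => F (⟨v, hv⟩ : A.adjoint.domain)) hh
  exact this

/-- Density of `H₊` makes `H → H₋` injective, so the graph is single-valued and `toLinearPMap` loses
nothing. -/
theorem mem_graph_quasiKernel (hA : IsAdmissible A) (B : HPlus A →L[ℂ] HMinus A) (p : H × H) :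
    p ∈ (quasiKernel B).graph ↔ ∃ f : HPlus A, inclPlus A f = p.1 ∧ B f = inclMinus A p.2 := by
  rw [quasiKernel, Submodule.toLinearPMap_graph_eq]
  · rfl
  · rintro ⟨x, h⟩ ⟨f, hf, hB⟩ (rfl : x = 0)
    have h0 : f = 0 := inclPlus_injective (by simpa using hf)
    rw [h0, map_zero] at hB
    exact inclMinus_injective hA (by rw [← hB, map_zero])

theorem im_apply_self_of_adj_eq {B : HPlus A →L[ℂ] HMinus A} (hB : adj B = B) (f : HPlus A) :
    (B f f).im = 0 := by
  rw [← Complex.conj_eq_iff_im, ← adj_apply, hB]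

theorem inclMinus_inclPlus_self (f : HPlus A) :
    inclMinus A (inclPlus A f) f = (‖inclPlus A f‖ ^ 2 : ℝ) := by
  rw [inclMinus_apply, inner_self_eq_norm_sq_to_K, Complex.ofReal_pow]
  rfl

/-- For a t-self-adjoint bi-extension `B` and non-real `z`, the range of `B - zI` contains `H`. -/
theorem exists_sub_smul_eq_inclMinus (hA : IsAdmissible A) {B : HPlus A →L[ℂ] HMinus A}
    (hB : IsTSelfAdjointBiExtension B) {z : ℂ} (hz : z.im ≠ 0) (h : H) :
    ∃ f : HPlus A, B f - z • inclMinus A (inclPlus A f) = inclMinus A h := by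
  obtain ⟨x, hx⟩ := exists_sub_smul_eq_of_isSelfAdjoint hB.quasiKernel_selfAdjoint hz h
  obtain ⟨f, hf, hBf⟩ := (mem_graph_quasiKernel hA B _).1 ((quasiKernel B).mem_graph x)
  refine ⟨f, ?_⟩
  rw [hBf, hf, ← map_smul, ← map_sub, hx]

theorem injective_sub_smul_of_adj_eq {B : HPlus A →L[ℂ] HMinus A} (hB : adj B = B) {z : ℂ}
    (hz : z.im ≠ 0) :
    Function.Injective fun f : HPlus A => B f - z • inclMinus A (inclPlus A f) := by
  let L : HPlus A →ₗ[ℂ] HMinus A :=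
    (B - z • (inclMinus A).comp (inclPlus A)).toLinearMap
  have : Function.Injective L := by
    rw [injective_iff_map_eq_zero]
    intro f hf
    have h1 : (B f - z • inclMinus A (inclPlus A f)) f = 0 := by
      change L f f = 0
      rw [hf]; rfl
    have h2 : B f f - z * inclMinus A (inclPlus A f) f = 0 := h1
    rw [inclMinus_inclPlus_self] at h2
    have h3 := congrArg Complex.im h2
    rw [Complex.sub_im, im_apply_self_of_adj_eq hB, Complex.im_mul_ofReal] at h3
    have h4 : ‖inclPlus A f‖ ^ 2 = 0 := by
      simpa [hz] using h3
    refine inclPlus_injective ?_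
    rw [map_zero]
    simpa using h4
  exact this

/-- `resolvent` is a choice of preimage; injectivity makes it agree with any explicit solution. -/
theorem resolvent_eq {B : HPlus A →L[ℂ] HMinus A} {z : ℂ}
    (hinj : Function.Injective fun f : HPlus A => B f - z • inclMinus A (inclPlus A f))
    {f : HPlus A} {φ : HMinus A} (hf : B f - z • inclMinus A (inclPlus A f) = φ) :
    resolvent B z φ = f := by
  rw [← hf]
  exact Function.leftInverse_invFun hinj f

/-- If `B ⊃ T` and `B* ⊃ T*`, where `T` has non-empty resolvent set, then the quasi-kernel of `B`
is contained in `T`. -/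
theorem exists_mem_domain_of_apply_eq {T : H →ₗ.[ℂ] H} (hT : Dense (T.domain : Set H))
    (hρ : (resolventSet T).Nonempty) {B : HPlus A →L[ℂ] HMinus A}
    (hB : Contains (adj B) T.adjoint) {f : HPlus A} {h : H} (hf : B f = inclMinus A h) :
    ∃ x : T.domain, (x : H) = inclPlus A f ∧ T x = h := by
  obtain ⟨z, R, hR1, hR2⟩ := hρ
  obtain ⟨x, -, hx⟩ := hR1 (h - z • inclPlus A f)
  -- With `x = R(h - zf)`, the difference `f - x` is tested on `w = (T* - z̄)y`, where `y = R*w`.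
  -- The inclusion `B* ⊃ T*` lets `T*` be moved from `y` onto `f`, and the terms with `z` cancel.
  have key : ∀ w : H, ⟪inclPlus A f - x, w⟫_ℂ = 0 := by
    intro w
    set y := R.adjoint w
    have hy : ∀ u : T.domain, ⟪w + (starRingEnd ℂ) z • y, (u : H)⟫_ℂ = ⟪y, T u⟫_ℂ := by
      intro u
      have h1 := hR2 u
      rw [map_sub, map_smul, sub_eq_iff_eq_add] at h1
      rw [ContinuousLinearMap.adjoint_inner_left, h1, inner_add_left, inner_smul_left,
        Complex.conj_conj, inner_add_right, inner_smul_right,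
        ContinuousLinearMap.adjoint_inner_left]
    have hdom : y ∈ T.adjoint.domain := LinearPMap.mem_adjoint_domain_of_exists _ ⟨_, hy⟩
    have hval : T.adjoint ⟨y, hdom⟩ = w + (starRingEnd ℂ) z • y :=
      LinearPMap.adjoint_apply_eq hT _ hy
    obtain ⟨g, hg1, hg2⟩ := hB ⟨y, hdom⟩
    have e1 : ⟪inclPlus A f, w + (starRingEnd ℂ) z • y⟫_ℂ = ⟪h, y⟫_ℂ := by
      have h2 := congrArg (fun F : HMinus A => F f) hg2
      simp only [adj_apply, hf, inclMinus_apply, hg1, hval, inner_conj_symm] at h2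
      exact h2.symm
    have e2 : ⟪(x : H), w + (starRingEnd ℂ) z • y⟫_ℂ = ⟪T x, y⟫_ℂ := by
      rw [← inner_conj_symm, hy x, inner_conj_symm]
    have e3 : h - T x = z • (inclPlus A f - x) := by
      rw [sub_eq_sub_iff_add_eq_add] at hx
      rw [smul_sub, sub_eq_sub_iff_add_eq_add, ← hx]
      abel
    have e4 : ⟪inclPlus A f - x, w + (starRingEnd ℂ) z • y⟫_ℂ =
        ⟪z • (inclPlus A f - x), y⟫_ℂ := by
      rw [inner_sub_left, e1, e2, ← inner_sub_left, e3]
    rw [inner_add_right, inner_smul_right, inner_smul_left] at e4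
    exact add_eq_right.1 e4
  have hv : inclPlus A f - x = 0 := inner_self_eq_zero.1 (key _)
  rw [sub_eq_zero] at hv
  refine ⟨x, hv.symm, ?_⟩
  rw [hv] at hx
  exact sub_left_injective hx

end Rigged

namespace LSystem

open Rigged

variable {H : Type*} [NormedAddCommGroup H] [InnerProductSpace ℂ H] [CompleteSpace H]
  (Θ : LSystem H ℂ)

/-! ### L-systems with input-output space `ℂ` and `J = 1` -/

theorem K_eq (e : ℂ) : Θ.K e = e • Θ.K 1 := by
  rw [← map_smul, smul_eq_mul, mul_one]

theorem channelAdjoint_eq (f : HPlus Θ.symmOp) :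
    channelAdjoint Θ.K f = (starRingEnd ℂ) (Θ.K 1 f) := by
  have h := inner_channelAdjoint Θ.K f 1
  simp only [RCLike.inner_apply, one_mul] at h
  rw [← h, Complex.conj_conj]

theorem rePart_adj : adj (rePart Θ.stateOp) = rePart Θ.stateOp :=
  Θ.stateOp_starExtension.re_tSelfAdjoint.biExtension.adj_eq

theorem rePart_conj (f g : HPlus Θ.symmOp) :
    (starRingEnd ℂ) (rePart Θ.stateOp f g) = rePart Θ.stateOp g f := by
  rw [← adj_apply, rePart_adj]

variable {Θ}

theorem imPart_apply (hJ : Θ.J = 1) (f : HPlus Θ.symmOp) :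
    imPart Θ.stateOp f = channelAdjoint Θ.K f • Θ.K 1 := by
  rw [Θ.im_stateOp, hJ, ← K_eq]
  rfl

theorem stateOp_apply (hJ : Θ.J = 1) (f : HPlus Θ.symmOp) :
    Θ.stateOp f = rePart Θ.stateOp f + (Complex.I * channelAdjoint Θ.K f) • Θ.K 1 := by
  rw [mul_smul, ← imPart_apply hJ, imPart, rePart]
  simp only [smul_apply, add_apply, sub_apply, smul_smul]
  have : Complex.I * (1 / (2 * Complex.I)) = 1 / 2 := by field_simp
  rw [this]
  module

theorem dense_mainOp_domain : Dense (Θ.mainOp.domain : Set H) :=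
  Θ.symmOp_admissible.dense.mono Θ.stateOp_starExtension.le.1

theorem exists_mainOp_of_stateOp_eq {f : HPlus Θ.symmOp} {h : H}
    (hf : Θ.stateOp f = inclMinus Θ.symmOp h) :
    ∃ x : Θ.mainOp.domain, (x : H) = inclPlus Θ.symmOp f ∧ Θ.mainOp x = h :=
  exists_mem_domain_of_apply_eq dense_mainOp_domain Θ.mainOp_mem.resolvent_nonempty
    Θ.stateOp_starExtension.adj_contains hf

/-- The channel vector is the difference of a value of `Re 𝔸` and a vector of `H`: otherwise the
main operator would be symmetric. -/
theorem exists_rePart_sub_eq_channel (hJ : Θ.J = 1) :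
    ∃ (f : HPlus Θ.symmOp) (h : H),
      rePart Θ.stateOp f - inclMinus Θ.symmOp h = Θ.K 1 := by
  by_contra! hne
  apply Θ.mainOp_mem.quasi.not_symmetric
  -- If `𝔸f = h` lies in `H`, then `Re 𝔸 f - h = -i(K*f) K 1`; a nonzero `K*f` could be divided out.
  -- So `K*` vanishes on `dom T`, where `𝔸` then equals the symmetric `Re 𝔸`.
  have hker : ∀ (f : HPlus Θ.symmOp) (h : H), Θ.stateOp f = inclMinus Θ.symmOp h →
      channelAdjoint Θ.K f = 0 := by
    intro f h hf
    by_contra h0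
    set k := Complex.I * channelAdjoint Θ.K f with hk
    have hk0 : k ≠ 0 := mul_ne_zero Complex.I_ne_zero h0
    refine hne ((-k⁻¹) • f) ((-k⁻¹) • h) ?_
    rw [stateOp_apply hJ, ← hk] at hf
    rw [map_smul, map_smul, ← hf, smul_add, smul_smul, neg_mul, inv_mul_cancel₀ hk0]
    module
  intro x y
  obtain ⟨f, hf1, hf2⟩ := Θ.stateOp_starExtension.contains x
  obtain ⟨g, hg1, hg2⟩ := Θ.stateOp_starExtension.contains y
  have h1 : Θ.stateOp f = rePart Θ.stateOp f := by
    rw [stateOp_apply hJ, hker f _ hf2, mul_zero]; module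
  have h2 : Θ.stateOp g = rePart Θ.stateOp g := by
    rw [stateOp_apply hJ, hker g _ hg2, mul_zero]; module
  have h3 := rePart_conj Θ f g
  rw [← h1, ← h2, hf2, hg2, inclMinus_apply, inclMinus_apply, hf1, hg1, inner_conj_symm] at h3
  exact h3

/-- For non-real `z`, the channel vector lies in the range of `Re 𝔸 - zI`. -/
theorem exists_rePart_sub_smul_eq_channel (hJ : Θ.J = 1) {z : ℂ} (hz : z.im ≠ 0) :
    ∃ x : HPlus Θ.symmOp,
      rePart Θ.stateOp x - z • inclMinus Θ.symmOp (inclPlus Θ.symmOp x) = Θ.K 1 := by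
  obtain ⟨f, h, hf⟩ := exists_rePart_sub_eq_channel hJ
  -- The right side is chosen so that `(Re 𝔸 - z)(f - y) = Re 𝔸 f - h = K 1`.
  obtain ⟨y, hy⟩ := exists_sub_smul_eq_inclMinus Θ.symmOp_admissible
    Θ.stateOp_starExtension.re_tSelfAdjoint hz (h - z • inclPlus Θ.symmOp f)
  refine ⟨f - y, ?_⟩
  rw [map_sub, map_smul] at hy
  rw [← hf, map_sub, map_sub, map_sub, smul_sub, sub_sub_sub_comm, hy]
  abel

theorem scalarImpedance_eq {z : ℂ} (hz : z.im ≠ 0) {x : HPlus Θ.symmOp}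
    (hx : rePart Θ.stateOp x - z • inclMinus Θ.symmOp (inclPlus Θ.symmOp x) = Θ.K 1) :
    Θ.scalarImpedance z = channelAdjoint Θ.K x := by
  rw [scalarImpedance, impedance,
    resolvent_eq (injective_sub_smul_of_adj_eq (rePart_adj Θ) hz) hx]

/-- Evaluating the defining equation of one resolvent vector at another. -/
theorem rePart_apply_sub_eq_conj {z w : ℂ} (hw : w.im ≠ 0) {x y : HPlus Θ.symmOp}
    (hx : rePart Θ.stateOp x - z • inclMinus Θ.symmOp (inclPlus Θ.symmOp x) = Θ.K 1)
    (hy : rePart Θ.stateOp y - w • inclMinus Θ.symmOp (inclPlus Θ.symmOp y) = Θ.K 1) :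
    rePart Θ.stateOp x y - z * ⟪inclPlus Θ.symmOp y, inclPlus Θ.symmOp x⟫_ℂ =
      (starRingEnd ℂ) (Θ.scalarImpedance w) := by
  rw [scalarImpedance_eq hw hy, channelAdjoint_eq, Complex.conj_conj, ← hx]
  rfl

/-- Pairing `(Re 𝔸 - z)x = K 1` with `x` itself leaves `Im V(z) = Im z ‖x‖²`. -/
theorem im_scalarImpedance (hJ : Θ.J = 1) {z : ℂ} (hz : z.im ≠ 0) :
    ∃ r : ℝ, 0 ≤ r ∧ (Θ.scalarImpedance z).im = z.im * r := by
  obtain ⟨x, hx⟩ := exists_rePart_sub_smul_eq_channel hJ hz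
  refine ⟨‖inclPlus Θ.symmOp x‖ ^ 2, by positivity, ?_⟩
  have h1 := rePart_apply_sub_eq_conj hz hx hx
  rw [← inclMinus_apply, inclMinus_inclPlus_self] at h1
  have h2 := congrArg Complex.im h1
  rw [Complex.sub_im, im_apply_self_of_adj_eq (rePart_adj Θ), Complex.im_mul_ofReal,
    Complex.conj_im] at h2
  linarith

theorem scalarImpedance_conj (hJ : Θ.J = 1) {z : ℂ} (hz : z.im ≠ 0) :
    Θ.scalarImpedance ((starRingEnd ℂ) z) = (starRingEnd ℂ) (Θ.scalarImpedance z) := by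
  have hz' : ((starRingEnd ℂ) z).im ≠ 0 := by simpa using hz
  obtain ⟨x, hx⟩ := exists_rePart_sub_smul_eq_channel hJ hz
  obtain ⟨y, hy⟩ := exists_rePart_sub_smul_eq_channel hJ hz'
  have h1 := rePart_apply_sub_eq_conj hz' hx hy
  have h2 := congrArg (starRingEnd ℂ) (rePart_apply_sub_eq_conj hz hy hx)
  rw [map_sub, map_mul, rePart_conj, inner_conj_symm, Complex.conj_conj, Complex.conj_conj,
    h1] at h2
  rw [← h2, Complex.conj_conj]

/-- Here `Re (1 + iV) = 1 - Im V ≥ 1`. In the upper half-plane this fails: functions of the class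
have `V(i) = i`, hence `1 + iV(i) = 0`. -/
theorem one_add_I_mul_scalarImpedance_ne_zero (hJ : Θ.J = 1) {z : ℂ} (hz : z.im < 0) :
    1 + Complex.I * Θ.scalarImpedance z ≠ 0 := by
  obtain ⟨r, hr, h⟩ := im_scalarImpedance hJ hz.ne
  intro h0
  have := congrArg Complex.re h0
  simp [h] at this
  nlinarith

/-! ### Dissipativity and the lower half-plane -/

theorem im_stateOp_apply_self (hJ : Θ.J = 1) (f : HPlus Θ.symmOp) :
    (Θ.stateOp f f).im = ‖channelAdjoint Θ.K f‖ ^ 2 := by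
  have h : Θ.stateOp f f = rePart Θ.stateOp f f +
      Complex.I * channelAdjoint Θ.K f * Θ.K 1 f := by
    conv_lhs => rw [stateOp_apply hJ]
    rfl
  have h2 : Θ.K 1 f = (starRingEnd ℂ) (channelAdjoint Θ.K f) := by
    rw [channelAdjoint_eq, Complex.conj_conj]
  rw [h, h2, mul_assoc, Complex.mul_conj, Complex.add_im, im_apply_self_of_adj_eq (rePart_adj Θ),
    Complex.im_mul_ofReal, Complex.normSq_eq_norm_sq]
  simp

theorem stateOp_injective (hJ : Θ.J = 1) {z : ℂ} (hz : z.im < 0) :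
    Function.Injective fun f : HPlus Θ.symmOp =>
      Θ.stateOp f - z • inclMinus Θ.symmOp (inclPlus Θ.symmOp f) := by
  let L : HPlus Θ.symmOp →ₗ[ℂ] HMinus Θ.symmOp :=
    (Θ.stateOp - z • (inclMinus Θ.symmOp).comp (inclPlus Θ.symmOp)).toLinearMap
  have : Function.Injective L := by
    rw [injective_iff_map_eq_zero]
    intro f hf
    have h1 : L f f = 0 := by rw [hf]; rfl
    have h2 : Θ.stateOp f f - z * inclMinus Θ.symmOp (inclPlus Θ.symmOp f) f = 0 := h1
    rw [inclMinus_inclPlus_self] at h2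
    have h3 := congrArg Complex.im h2
    rw [Complex.sub_im, im_stateOp_apply_self hJ, Complex.im_mul_ofReal, Complex.zero_im] at h3
    have h4 : ‖inclPlus Θ.symmOp f‖ ^ 2 = 0 := by
      nlinarith [sq_nonneg ‖inclPlus Θ.symmOp f‖, sq_nonneg ‖channelAdjoint Θ.K f‖]
    refine inclPlus_injective ?_
    rw [map_zero]
    simpa using h4
  exact this

/-- If `x` solves `(Re 𝔸 - zI) x = K 1`, then `(𝔸 - zI) x = (1 + i V(z)) K 1`. -/
theorem stateOp_sub_smul_eq (hJ : Θ.J = 1) {z : ℂ} (hz : z.im ≠ 0) {x : HPlus Θ.symmOp}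
    (hx : rePart Θ.stateOp x - z • inclMinus Θ.symmOp (inclPlus Θ.symmOp x) = Θ.K 1) :
    Θ.stateOp x - z • inclMinus Θ.symmOp (inclPlus Θ.symmOp x) =
      (1 + Complex.I * Θ.scalarImpedance z) • Θ.K 1 := by
  rw [stateOp_apply hJ, add_sub_right_comm, hx, scalarImpedance_eq hz hx]
  module

/-- The main operator is dissipative. -/
theorem norm_le_mainOp_sub_smul (hJ : Θ.J = 1) (z : ℂ) (x : Θ.mainOp.domain) :
    -z.im * ‖(x : H)‖ ≤ ‖Θ.mainOp x - z • (x : H)‖ := by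
  refine le_norm_of_im_inner ?_
  obtain ⟨f, hf1, hf2⟩ := Θ.stateOp_starExtension.contains x
  have h1 := im_stateOp_apply_self hJ f
  rw [hf2, inclMinus_apply, hf1] at h1
  rw [im_inner_sub_smul, h1]
  refine le_trans ?_ (le_abs_self _)
  nlinarith [sq_nonneg ‖channelAdjoint Θ.K f‖]

/-- Rank-one correction: if `(Re 𝔸 - z)y = h`, then `(𝔸 - z)y` exceeds `h` by a multiple of `K 1`,
removed by a multiple of the vector `x` with `(𝔸 - z)x = (1 + iV) K 1`. The result has `𝔸f ∈ H`,
hence lies in `dom T`. -/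
theorem exists_mainOp_sub_smul_eq (hJ : Θ.J = 1) {z : ℂ} (hz : z.im < 0) (h : H) :
    ∃ x : Θ.mainOp.domain, Θ.mainOp x - z • (x : H) = h := by
  obtain ⟨x, hx⟩ := exists_rePart_sub_smul_eq_channel hJ hz.ne
  obtain ⟨y, hy⟩ := exists_sub_smul_eq_inclMinus Θ.symmOp_admissible
    Θ.stateOp_starExtension.re_tSelfAdjoint hz.ne h
  have hV := one_add_I_mul_scalarImpedance_ne_zero hJ hz
  set k := Complex.I * channelAdjoint Θ.K y with hk
  set f := y - (k / (1 + Complex.I * Θ.scalarImpedance z)) • x with hf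
  have h1 : Θ.stateOp f - z • inclMinus Θ.symmOp (inclPlus Θ.symmOp f) =
      inclMinus Θ.symmOp h := by
    have e1 := stateOp_sub_smul_eq hJ hz.ne hx
    have e2 : Θ.stateOp y - z • inclMinus Θ.symmOp (inclPlus Θ.symmOp y) =
        inclMinus Θ.symmOp h + k • Θ.K 1 := by
      rw [stateOp_apply hJ, add_sub_right_comm, hy]
    have e3 : Θ.stateOp f - z • inclMinus Θ.symmOp (inclPlus Θ.symmOp f) =
        (Θ.stateOp y - z • inclMinus Θ.symmOp (inclPlus Θ.symmOp y)) -
        (k / (1 + Complex.I * Θ.scalarImpedance z)) •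
          (Θ.stateOp x - z • inclMinus Θ.symmOp (inclPlus Θ.symmOp x)) := by
      rw [hf]
      simp only [map_sub, map_smul]
      module
    rw [e3, e1, e2, smul_smul, div_mul_cancel₀ _ hV, add_sub_cancel_right]
  have h2 : Θ.stateOp f = inclMinus Θ.symmOp (h + z • inclPlus Θ.symmOp f) := by
    rw [map_add, map_smul, ← h1, sub_add_cancel]
  obtain ⟨u, hu1, hu2⟩ := exists_mainOp_of_stateOp_eq h2
  exact ⟨u, by rw [hu1, hu2, add_sub_cancel_right]⟩

/-- The open lower half-plane lies in the resolvent set of the main operator. -/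
theorem mem_resolventSet (hJ : Θ.J = 1) {z : ℂ} (hz : z.im < 0) :
    z ∈ resolventSet Θ.mainOp := by
  let L : Θ.mainOp.domain →ₗ[ℂ] H := Θ.mainOp.toFun - z • Θ.mainOp.domain.subtype
  have hL : ∀ x, L x = Θ.mainOp x - z • (x : H) := fun x => rfl
  have hbound : ∀ x : Θ.mainOp.domain, -z.im * ‖(x : H)‖ ≤ ‖L x‖ := norm_le_mainOp_sub_smul hJ z
  have hbij : Function.Bijective L := by
    refine ⟨?_, exists_mainOp_sub_smul_eq hJ hz⟩
    rw [injective_iff_map_eq_zero]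
    intro x hx
    have h1 := hbound x
    rw [hx, norm_zero] at h1
    have h2 : ‖(x : H)‖ ≤ 0 := by nlinarith [norm_nonneg (x : H)]
    exact Subtype.ext (norm_le_zero_iff.1 h2)
  let e := LinearEquiv.ofBijective L hbij
  have he : ∀ h, L (e.symm h) = h := e.apply_symm_apply
  refine ⟨(Θ.mainOp.domain.subtype ∘ₗ e.symm.toLinearMap).mkContinuous (-z.im)⁻¹ fun h => ?_,
    fun h => ⟨e.symm h, rfl, he h⟩, fun x => ?_⟩
  · have h1 := hbound (e.symm h)
    rw [he] at h1
    rw [inv_mul_eq_div, le_div_iff₀' (by linarith)]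
    exact h1
  · exact congrArg Subtype.val (e.symm_apply_apply x)

/-! ### Transfer function and rotation of the impedance -/

/-- `W(z) = (1 - i V(z)) / (1 + i V(z))` in the lower half-plane. -/
theorem transfer_eq (hJ : Θ.J = 1) {z : ℂ} (hz : z.im < 0) (e : ℂ) :
    Θ.transfer z e =
      (1 - Complex.I * Θ.scalarImpedance z) / (1 + Complex.I * Θ.scalarImpedance z) * e := by
  obtain ⟨x, hx⟩ := exists_rePart_sub_smul_eq_channel hJ hz.ne
  have hV := one_add_I_mul_scalarImpedance_ne_zero hJ hz
  set d := 1 + Complex.I * Θ.scalarImpedance z with hd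
  have h1 : Θ.stateOp ((e / d) • x) -
      z • inclMinus Θ.symmOp (inclPlus Θ.symmOp ((e / d) • x)) = Θ.K e := by
    have h2 : Θ.stateOp ((e / d) • x) -
        z • inclMinus Θ.symmOp (inclPlus Θ.symmOp ((e / d) • x)) =
        (e / d) • (Θ.stateOp x - z • inclMinus Θ.symmOp (inclPlus Θ.symmOp x)) := by
      simp only [map_smul]
      module
    rw [h2, stateOp_sub_smul_eq hJ hz.ne hx, ← hd, smul_smul, div_mul_cancel₀ _ hV, ← K_eq]
  rw [transfer, hJ, one_apply_eq_self, resolvent_eq (stateOp_injective hJ hz) h1,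
    map_smul, ← scalarImpedance_eq hz.ne hx, smul_eq_mul, smul_eq_mul]
  field_simp
  rw [hd]
  ring

/-- The impedance functions of an L-system and of its unimodular transformation are related by a
rotation of the half-plane. -/
theorem scalarImpedance_rotation {H' : Type*} [NormedAddCommGroup H'] [InnerProductSpace ℂ H']
    [CompleteSpace H'] {Θ' : LSystem H' ℂ} {α : ℝ} (hα : Θ'.IsUnimodularTransformation Θ α)
    {z : ℂ} (hz : z.im ≠ 0) :
    Θ'.scalarImpedance z * ((Real.sin α : ℝ) - (Real.cos α : ℝ) * Θ.scalarImpedance z) =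
      (Real.cos α : ℝ) + (Real.sin α : ℝ) * Θ.scalarImpedance z := by
  have lower : ∀ w : ℂ, w.im < 0 →
      Θ'.scalarImpedance w * ((Real.sin α : ℝ) - (Real.cos α : ℝ) * Θ.scalarImpedance w) =
        (Real.cos α : ℝ) + (Real.sin α : ℝ) * Θ.scalarImpedance w := by
    intro w hw
    have h := hα.transfer_eq w
      ⟨mem_resolventSet hα.J_eq hw, mem_resolventSet hα.J_eq' hw⟩ 1
    rw [transfer_eq hα.J_eq hw, transfer_eq hα.J_eq' hw, mul_one, mul_one] at h
    have hV := one_add_I_mul_scalarImpedance_ne_zero hα.J_eq hw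
    have hV' := one_add_I_mul_scalarImpedance_ne_zero hα.J_eq' hw
    set V := Θ.scalarImpedance w
    set V' := Θ'.scalarImpedance w
    have hexp : Complex.exp (2 * Complex.I * (α : ℂ)) =
        ((Real.cos α : ℝ) + (Real.sin α : ℝ) * Complex.I) ^ 2 := by
      rw [Complex.ofReal_cos, Complex.ofReal_sin, ← Complex.exp_mul_I, ← Complex.exp_nat_mul]
      congr 1
      push_cast
      ring
    have hcs : ((Real.cos α : ℝ) : ℂ) ^ 2 + ((Real.sin α : ℝ) : ℂ) ^ 2 = 1 := by
      exact_mod_cast Real.cos_sq_add_sin_sq α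
    rw [hexp, div_mul_eq_mul_div, div_eq_div_iff hV' hV] at h
    generalize ((Real.cos α : ℝ) : ℂ) = c at *
    generalize ((Real.sin α : ℝ) : ℂ) = s at *
    have hI := Complex.I_sq
    -- The cross-multiplied relation times `e^{-iα}`, which balances the phases so that expansion
    -- leaves only real coefficients `c` and `s`.
    have h1 : (c - s * Complex.I) * ((1 - Complex.I * V') * (1 + Complex.I * V)) +
        (c + s * Complex.I) * ((1 - Complex.I * V) * (1 + Complex.I * V')) = 0 := by
      have h2 : (c - s * Complex.I) * (c + s * Complex.I) = 1 := by
        linear_combination hcs - s ^ 2 * hI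
      rw [h]
      linear_combination
        (-(c + s * Complex.I) * ((1 - Complex.I * V) * (1 + Complex.I * V'))) * h2
    have h3 : 2 * (V' * (s - c * V) - (c + s * V)) = 0 := by
      linear_combination -h1 + (-2 * c * V * V' + 2 * s * V' - 2 * s * V) * hI
    have h4 := (mul_eq_zero.1 h3).resolve_left two_ne_zero
    exact sub_eq_zero.1 h4
  rcases hz.lt_or_gt with h | h
  · exact lower z h
  -- The rotation has real coefficients, so conjugation carries it to the upper half-plane, where
  -- `ρ(T)` is not controlled.
  · have h1 := lower ((starRingEnd ℂ) z) (by simpa using h)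
    rw [scalarImpedance_conj hα.J_eq hz, scalarImpedance_conj hα.J_eq' hz] at h1
    have h2 := congrArg (starRingEnd ℂ) h1
    simpa only [map_mul, map_sub, map_add, Complex.conj_conj, Complex.conj_ofReal] using h2

end LSystem

theorem theorem5p2 {H H' : Type*}
    [NormedAddCommGroup H] [InnerProductSpace ℂ H] [CompleteSpace H]
    [NormedAddCommGroup H'] [InnerProductSpace ℂ H'] [CompleteSpace H']
    (Θ : LSystem H ℂ) (Θα : LSystem H' ℂ) (α : ℝ)
    (hα : Θα.IsUnimodularTransformation Θ α)
    (hV : IsDonoghue Θ.scalarImpedance) :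
    IsDonoghue Θα.scalarImpedance :=
  Herglotz.isDonoghue_of_rotation (Real.cos_sq_add_sin_sq α) hV fun _ hz =>
    LSystem.scalarImpedance_rotation hα hz.ne'
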